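/- Let $p$ be a prime, let $V$ be a complete discrete valuation ring of mixed characteristic $(0,p)$ with finite residue field of $q$ elements, let $K$ be its fraction field with the norm normalized by $|p|=p^{-1}$, and let $\pi\in K$ satisfy $\pi^{q-1}+(-p)^{(q-1)/(p-1)}=0$. Write $\partial^{[k]}=\partial^k/k!$, and let $$A_1(K)^\dagger=\Big\{\sum_{l,k\ge 0}a_{l,k}x^l\partial^{[k]} : a_{l,k}\in K,\ \exists\, C>0,\ \exists\, \eta<1,\ |a_{l,k}|<C\eta^{l+k}\Big\},$$ $$B_1(K)^\dagger=\Big\{\sum_{l\in\mathbb Z,\,k\ge 0}a_{l,k}x^l\partial^{[k]} : a_{l,k}\in K,\ \exists\, C>0,\ \exists\, \eta<1,\ |a_{l,k}|<C\eta^{|l|+k}\Big\}$$ be the rings of overconvergent differential operators on the affine line and on $\mathbb G_m$ (multiplied as differential operators, $\partial x-x\partial=1$). For a left $A_1(K)^\dagger$-module $M$ put $j^*M=B_1(K)^\dagger\otimes_{A_1(K)^\dagger}M$, and for a left $B_1(K)^\dagger$-module $N$ let $j_+N$ be $N$ regarded as an $A_1(K)^\dagger$-module. An element $\alpha\in\mathbb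 Z_p$ is called a $p$-adic Liouville number if one of the power series $\sum_{k\ge0,\,k\ne\alpha}t^k/(\alpha-k)$, $\sum_{k\ge0,\,k\ne-\alpha}t^k/(\alpha+k)$ has radius of convergence strictly less than $1$. Let $m,n\ge 0$ and let $\alpha_1,\dots,\alpha_m,\beta_1,\dots,\beta_n\in\mathbb Z_p$, where no $\alpha_i$ is an integer or a $p$-adic Liouville number. Put $$\mathrm{Hyp}_\pi(\alpha;\beta)=\prod_{i=1}^m(x\partial-\alpha_i)-(-1)^{m+np}\pi^{m-n}x\prod_{j=1}^n(x\partial-\beta_j),$$ $M=A_1(K)^\dagger/A_1(K)^\dagger\,\mathrm{Hyp}_\pi(\alpha;\beta)$ and $\mathcal H_\pi(\alpha;\beta)=B_1(K)^\dagger/B_1(K)^\dagger\,\mathrm{Hyp}_\pi(\alpha;\beta)$. Then: 1. left multiplication by $x$ is bijective on $M$; 2. $j^*M$ is isomorphic to $\mathcal H_\pi(\alpha;\beta)$ as a $B_1(K)^\dagger$-module; 3. the natural morphism $M\to j_+j^*M$, $v\mapsto 1\otimes v$, of $A_1(K)^\dagger$-modules is an isomorphism. -/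

import Mathlib

noncomputable section

namespace ArithD

set_option linter.unusedSectionVars false

section Operators

variable (K : Type*) [NontriviallyNormedField K]

/-- Formal Laurent series `∑ fₙ xⁿ` (`n ∈ ℤ`) with bounded coefficients in `K`, with the sup norm. -/
def BoundedLaurent : Type _ := BoundedContinuousFunction ℤ K

namespace BoundedLaurent

instance : NormedAddCommGroup (BoundedLaurent K) :=
  inferInstanceAs (NormedAddCommGroup (BoundedContinuousFunction ℤ K))

instance : NormedSpace K (BoundedLaurent K) :=
  inferInstanceAs (NormedSpace K (BoundedContinuousFunction ℤ K))

instance [CompleteSpace K] : CompleteSpace (BoundedLaurent K) :=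
  inferInstanceAs (CompleteSpace (BoundedContinuousFunction ℤ K))

variable {K}

/-- The coefficient of `xⁿ`. -/
def coeff (f : BoundedLaurent K) (n : ℤ) : K := DFunLike.coe (F := BoundedContinuousFunction ℤ K) f n

/-- The series with given bounded coefficients. -/
def ofBounded (u : ℤ → K) (C : ℝ) (h : ∀ n, ‖u n‖ ≤ C) : BoundedLaurent K :=
  BoundedContinuousFunction.ofNormedAddCommGroupDiscrete u C h

@[ext] lemma ext {f g : BoundedLaurent K} (h : ∀ n, f.coeff n = g.coeff n) : f = g :=
  BoundedContinuousFunction.ext h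

@[simp] lemma coeff_ofBounded (u : ℤ → K) (C : ℝ) (h : ∀ n, ‖u n‖ ≤ C) (n : ℤ) :
    (ofBounded u C h).coeff n = u n := rfl

@[simp] lemma coeff_add (f g : BoundedLaurent K) (n : ℤ) :
    (f + g).coeff n = f.coeff n + g.coeff n := rfl

@[simp] lemma coeff_smul (c : K) (f : BoundedLaurent K) (n : ℤ) :
    (c • f).coeff n = c * f.coeff n := rfl

lemma norm_coeff_le (f : BoundedLaurent K) (n : ℤ) : ‖f.coeff n‖ ≤ ‖f‖ :=
  BoundedContinuousFunction.norm_coe_le_norm (α := ℤ) (β := K) f n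

lemma norm_le {f : BoundedLaurent K} {C : ℝ} (hC : 0 ≤ C) (h : ∀ n, ‖f.coeff n‖ ≤ C) : ‖f‖ ≤ C :=
  (BoundedContinuousFunction.norm_le (α := ℤ) (β := K) (f := f) hC).2 h

end BoundedLaurent

/-- The Banach algebra of bounded `K`-linear operators on bounded Laurent series. -/
def OpAlg : Type _ := BoundedLaurent K →L[K] BoundedLaurent K

namespace OpAlg

instance : NormedRing (OpAlg K) :=
  inferInstanceAs (NormedRing (BoundedLaurent K →L[K] BoundedLaurent K))

instance : NormedAlgebra K (OpAlg K) :=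
  inferInstanceAs (NormedAlgebra K (BoundedLaurent K →L[K] BoundedLaurent K))

instance [CompleteSpace K] : CompleteSpace (OpAlg K) :=
  inferInstanceAs (CompleteSpace (BoundedLaurent K →L[K] BoundedLaurent K))

variable {K}

/-- The action of an operator on a series. -/
def apply (T : OpAlg K) (f : BoundedLaurent K) : BoundedLaurent K :=
  DFunLike.coe (F := BoundedLaurent K →L[K] BoundedLaurent K) T f

@[ext] lemma ext {S T : OpAlg K} (h : ∀ f, S.apply f = T.apply f) : S = T :=
  ContinuousLinearMap.ext h

@[simp] lemma one_apply (f : BoundedLaurent K) : (1 : OpAlg K).apply f = f := rfl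

@[simp] lemma mul_apply (S T : OpAlg K) (f : BoundedLaurent K) :
    (S * T).apply f = S.apply (T.apply f) := rfl

/-- For fixed `f` and `m`, the coefficient of `x ^ m` in `T f`, as a continuous linear form in the
operator `T`. -/
def coeffL (f : BoundedLaurent K) (m : ℤ) : OpAlg K →L[K] K :=
  LinearMap.mkContinuous
    { toFun := fun T => (T.apply f).coeff m
      map_add' := fun _ _ => rfl
      map_smul' := fun _ _ => rfl } ‖f‖
    (fun T => ((T.apply f).norm_coeff_le m).trans
      ((ContinuousLinearMap.le_opNorm (𝕜 := K) (𝕜₂ := K) (E := BoundedLaurent K)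
        (F := BoundedLaurent K) T f).trans (mul_comm _ _).le))

lemma coeffL_apply (f : BoundedLaurent K) (m : ℤ) (T : OpAlg K) :
    coeffL f m T = (T.apply f).coeff m := rfl

end OpAlg

variable [IsUltrametricDist K]

variable {K} in
lemma norm_choose_mul_le (f : BoundedLaurent K) (l : ℤ) (k : ℕ) (m : ℤ) :
    ‖((Ring.choose (m - l + k) k : ℤ) : K) * f.coeff (m - l + k)‖ ≤ ‖f‖ := by
  rw [norm_mul]
  calc _ ≤ 1 * ‖f‖ := by
        gcongr
        · exact IsUltrametricDist.norm_intCast_le_one K _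
        · exact f.norm_coeff_le _
    _ = ‖f‖ := one_mul _

/-- The differential operator `x ^ l ∂^[k]`, where `∂^[k] = ∂ ^ k / k!`, acting on Laurent series:
it sends `xⁿ` to `(n choose k) x^(n - k + l)`.  Accordingly the coefficient of `x ^ m` in
`x ^ l ∂^[k] f` is `(m - l + k choose k) f_{m - l + k}`. -/
def monoOp (l : ℤ) (k : ℕ) : OpAlg K :=
  LinearMap.mkContinuous
    { toFun := fun f => BoundedLaurent.ofBounded
        (fun m : ℤ => ((Ring.choose (m - l + k) k : ℤ) : K) * f.coeff (m - l + k)) ‖f‖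
        (norm_choose_mul_le f l k)
      map_add' := fun f g => by ext m; simp [mul_add]
      map_smul' := fun c f => by ext m; simp [mul_left_comm] }
    1 (fun f => by
      rw [one_mul]
      exact BoundedLaurent.norm_le (norm_nonneg f) (norm_choose_mul_le f l k))

lemma monoOp_apply (l : ℤ) (k : ℕ) (f : BoundedLaurent K) (m : ℤ) :
    ((monoOp K l k).apply f).coeff m =
      ((Ring.choose (m - l + k) k : ℤ) : K) * f.coeff (m - l + k) := rfl

lemma norm_monoOp_le (l : ℤ) (k : ℕ) : ‖monoOp K l k‖ ≤ 1 :=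
  LinearMap.mkContinuous_norm_le _ zero_le_one _

lemma monoOp_zero_zero : monoOp K 0 0 = 1 := by
  ext f m
  simp [monoOp_apply]

/-- Composition of monomial operators. -/
lemma monoOp_mul (l l' : ℤ) (k k' : ℕ) :
    monoOp K l k * monoOp K l' k' =
      ∑ j ∈ Finset.range (k + 1),
        ((Ring.choose l' j * ((k + k' - j).choose k' : ℤ) : ℤ) : K) •
          monoOp K (l + l' - j) (k + k' - j) := by
  ext f m
  have key : ∀ n : ℤ, Ring.choose (n - k' + l') k * Ring.choose n k' =
      ∑ j ∈ Finset.range (k + 1), (Ring.choose l' j * ((k + k' - j).choose k' : ℤ)) *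
        Ring.choose n (k + k' - j) := by
    intro n
    rw [add_comm, Ring.add_choose_eq k (Commute.all _ _), Finset.Nat.sum_antidiagonal_eq_sum_range_succ
      (fun i j => Ring.choose l' i * Ring.choose (n - (k' : ℤ)) j), Finset.sum_mul]
    refine Finset.sum_congr rfl fun j hj => ?_
    have hj : j ≤ k := by simpa [Nat.lt_succ_iff] using hj
    have h := Ring.choose_add_smul_choose (n - (k' : ℤ)) (k - j) k'
    rw [sub_add_cancel, nsmul_eq_mul, show k - j + k' = k + k' - j by omega] at h
    rw [mul_assoc, mul_comm (Ring.choose (n - (k' : ℤ)) (k - j)), ← h]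
    ring
  rw [OpAlg.mul_apply, monoOp_apply, monoOp_apply, ← mul_assoc,
    show m - l + k - l' + k' = m - l - l' + k + k' by ring, ← Int.cast_mul]
  have h := key (m - l - l' + k + k')
  rw [show m - l - l' + k + k' - k' + l' = m - l + k by ring] at h
  rw [h]
  rw [← OpAlg.coeffL_apply f m (∑ _ ∈ _, _), map_sum, Int.cast_sum, Finset.sum_mul]
  refine Finset.sum_congr rfl fun j hj => ?_
  have hj : j ≤ k := by simpa [Nat.lt_succ_iff] using hj
  have : m - (l + l' - j) + ((k + k' - j : ℕ) : ℤ) = m - l - l' + k + k' := by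
    rw [Nat.cast_sub (by omega)]; push_cast; ring
  rw [map_smul, OpAlg.coeffL_apply, smul_eq_mul, monoOp_apply, this]
  push_cast; ring

variable {K} in
/-- `∃ C > 0, ∃ η < 1, |a_{l,k}| < C η ^ (max (l, -l) + k)`. -/
def IsOverconvergentB (a : ℤ → ℕ → K) : Prop :=
  ∃ C : ℝ, 0 < C ∧ ∃ η : ℝ, 0 < η ∧ η < 1 ∧ ∀ l k, ‖a l k‖ < C * η ^ (l.natAbs + k)

variable {K} in
/-- `∃ C > 0, ∃ η < 1, |a_{l,k}| < C η ^ (l + k)`. -/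
def IsOverconvergentA (a : ℕ → ℕ → K) : Prop :=
  ∃ C : ℝ, 0 < C ∧ ∃ η : ℝ, 0 < η ∧ η < 1 ∧ ∀ l k, ‖a l k‖ < C * η ^ (l + k)

variable {K} in
/-- One can choose the constant `η` in the decay condition closer to `1`. -/
lemma IsOverconvergentB.mono_rate {a : ℤ → ℕ → K} {C η η' : ℝ} (hC : 0 < C) (h0 : 0 < η)
    (hη : η ≤ η') (h : ∀ l k, ‖a l k‖ < C * η ^ (l.natAbs + k)) (l : ℤ) (k : ℕ) :
    ‖a l k‖ < C * η' ^ (l.natAbs + k) :=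
  (h l k).trans_le (by gcongr)

variable {K} in
lemma IsOverconvergentB.add {a b : ℤ → ℕ → K} (ha : IsOverconvergentB a)
    (hb : IsOverconvergentB b) : IsOverconvergentB (fun l k => a l k + b l k) := by
  obtain ⟨C, hC, η, h0, h1, h⟩ := ha
  obtain ⟨C', hC', η', h0', h1', h'⟩ := hb
  refine ⟨C + C', by positivity, max η η', lt_max_of_lt_left h0, max_lt h1 h1', fun l k => ?_⟩
  have e1 := mono_rate hC h0 (le_max_left η η') h l k
  have e2 := mono_rate hC' h0' (le_max_right η η') h' l k
  calc _ ≤ ‖a l k‖ + ‖b l k‖ := norm_add_le _ _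
    _ < _ := by rw [add_mul]; exact add_lt_add e1 e2

/-- Index set for the expansion of a product of two series. -/
abbrev MulIndex : Type := ((ℤ × ℕ) × (ℤ × ℕ)) × ℕ

/-- Exponents of the `j`-th monomial in `(x ^ l ∂^[k]) (x ^ l' ∂^[k'])`. -/
def mulExp (q : MulIndex) : ℤ × ℕ :=
  (q.1.1.1 + q.1.2.1 - q.2, q.1.1.2 + q.1.2.2 - q.2)

variable {K} in
/-- Coefficient of the `j`-th monomial in `(a x ^ l ∂^[k]) (b x ^ l' ∂^[k'])`. -/
def mulTerm (a b : ℤ → ℕ → K) (q : MulIndex) : K :=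
  if q.2 ≤ q.1.1.2 then
    a q.1.1.1 q.1.1.2 * b q.1.2.1 q.1.2.2 *
      ((Ring.choose q.1.2.1 q.2 *
        ((q.1.1.2 + q.1.2.2 - q.2).choose q.1.2.2 : ℤ) : ℤ) : K)
  else 0

variable {K} in
/-- Coefficients of the product of two series. -/
def mulCoeff (a b : ℤ → ℕ → K) (l : ℤ) (k : ℕ) : K :=
  ∑' q : mulExp ⁻¹' {(l, k)}, mulTerm a b q

lemma summable_pow_natAbs_add {θ : ℝ} (h0 : 0 < θ) (h1 : θ < 1) :
    Summable fun i : ℤ × ℕ => θ ^ (i.1.natAbs + i.2) := by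
  have hN : Summable fun n : ℕ => θ ^ n := summable_geometric_of_lt_one h0.le h1
  have hZ : Summable fun n : ℤ => θ ^ n.natAbs :=
    Summable.of_nat_of_neg (by simpa using hN) (by simpa using hN)
  simpa only [pow_add] using
    hZ.mul_of_nonneg hN (fun _ => by positivity) (fun _ => by positivity)

section Bounds

variable {K}
variable {a b : ℤ → ℕ → K} {C C' η : ℝ}

lemma norm_mulTerm_le (ha : ∀ l k, ‖a l k‖ < C * η ^ (l.natAbs + k))
    (hb : ∀ l k, ‖b l k‖ < C' * η ^ (l.natAbs + k)) (q : MulIndex) (hq : q.2 ≤ q.1.1.2) :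
    ‖mulTerm a b q‖ ≤
      (C * η ^ (q.1.1.1.natAbs + q.1.1.2)) * (C' * η ^ (q.1.2.1.natAbs + q.1.2.2)) := by
  rw [mulTerm, if_pos hq, norm_mul, norm_mul]
  have h1 := IsUltrametricDist.norm_intCast_le_one K (Ring.choose q.1.2.1 q.2 *
        ((q.1.1.2 + q.1.2.2 - q.2).choose q.1.2.2 : ℤ))
  have h2 := ha q.1.1.1 q.1.1.2
  have h3 := hb q.1.2.1 q.1.2.2
  have h4 := (norm_nonneg _).trans h2.le
  calc _ ≤ ‖a q.1.1.1 q.1.1.2‖ * ‖b q.1.2.1 q.1.2.2‖ * 1 := by gcongr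
    _ ≤ _ := by rw [mul_one]; gcongr

lemma norm_mulTerm_le' (hC : 0 < C) (hC' : 0 < C') (h0 : 0 < η) (h1 : η < 1)
    (ha : ∀ l k, ‖a l k‖ < C * η ^ (l.natAbs + k))
    (hb : ∀ l k, ‖b l k‖ < C' * η ^ (l.natAbs + k)) (q : MulIndex) :
    ‖mulTerm a b q‖ ≤ C * C' * η ^ ((mulExp q).1.natAbs + (mulExp q).2) := by
  by_cases hq : q.2 ≤ q.1.1.2
  · refine (norm_mulTerm_le ha hb q hq).trans ?_
    rw [mul_mul_mul_comm, ← pow_add]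
    refine mul_le_mul_of_nonneg_left (pow_le_pow_of_le_one h0.le h1.le ?_) (by positivity)
    simp only [mulExp]
    omega
  · rw [mulTerm, if_neg hq, norm_zero]
    positivity

lemma summable_norm_mulTerm (hC : 0 < C) (hC' : 0 < C') (h0 : 0 < η) (h1 : η < 1)
    (ha : ∀ l k, ‖a l k‖ < C * η ^ (l.natAbs + k))
    (hb : ∀ l k, ‖b l k‖ < C' * η ^ (l.natAbs + k)) :
    Summable fun q : MulIndex => ‖mulTerm a b q‖ := by
  set θ := Real.sqrt η with hθ
  have t0 : 0 < θ := Real.sqrt_pos.2 h0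
  have t1 : θ < 1 := by rw [hθ, Real.sqrt_lt' one_pos]; simpa using h1
  have tη : η = θ ^ 2 := (Real.sq_sqrt h0.le).symm
  have hs := summable_pow_natAbs_add t0 t1
  have hN : Summable fun n : ℕ => θ ^ n := summable_geometric_of_lt_one t0.le t1
  have h2 := ((hs.mul_of_nonneg hs (fun _ => by positivity) (fun _ => by positivity)).mul_of_nonneg
    hN (fun _ => by positivity) (fun _ => by positivity)).mul_left (C * C')
  refine Summable.of_nonneg_of_le (fun _ => norm_nonneg _) (fun q => ?_) h2
  by_cases hq : q.2 ≤ q.1.1.2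
  · refine (norm_mulTerm_le ha hb q hq).trans ?_
    rw [mul_mul_mul_comm, ← pow_add, ← pow_add, ← pow_add, tη, ← pow_mul]
    refine mul_le_mul_of_nonneg_left (pow_le_pow_of_le_one t0.le t1.le ?_) (by positivity)
    omega
  · rw [mulTerm, if_neg hq, norm_zero]
    positivity

lemma isOverconvergentB_mulCoeff (ha : IsOverconvergentB a) (hb : IsOverconvergentB b) :
    IsOverconvergentB (mulCoeff a b) := by
  obtain ⟨C, hC, η, h0, h1, h⟩ := ha
  obtain ⟨C', hC', η', h0', h1', h'⟩ := hb
  have e1 := IsOverconvergentB.mono_rate hC h0 (le_max_left η η') h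
  have e2 := IsOverconvergentB.mono_rate hC' h0' (le_max_right η η') h'
  have m0 : 0 < max η η' := lt_max_of_lt_left h0
  refine ⟨C * C' + 1, by positivity, max η η', m0, max_lt h1 h1', fun l k => ?_⟩
  have : ‖mulCoeff a b l k‖ ≤ C * C' * (max η η') ^ (l.natAbs + k) := by
    refine IsUltrametricDist.norm_tsum_le_of_forall_le_of_nonneg (by positivity) fun q => ?_
    have hq : mulExp q = (l, k) := q.2
    simpa [hq] using norm_mulTerm_le' hC hC' m0 (max_lt h1 h1') e1 e2 q.1
  refine this.trans_lt ?_
  have : 0 < (max η η') ^ (l.natAbs + k) := by positivity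
  linarith

lemma mulCoeff_of_neg (ha : ∀ l k, l < 0 → a l k = 0) (hb : ∀ l k, l < 0 → b l k = 0)
    (l : ℤ) (k : ℕ) (hl : l < 0) : mulCoeff a b l k = 0 := by
  refine (tsum_congr fun q => ?_).trans tsum_zero
  obtain ⟨⟨⟨⟨l₁, k₁⟩, ⟨l₂, k₂⟩⟩, j⟩, hq⟩ := q
  have hq : mulExp (((l₁, k₁), (l₂, k₂)), j) = (l, k) := hq
  simp only [mulExp, Prod.mk.injEq] at hq
  simp only [mulTerm]
  split_ifs with hj
  · by_cases h1 : l₁ < 0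
    · simp [ha l₁ k₁ h1]
    by_cases h2 : l₂ < 0
    · simp [hb l₂ k₂ h2]
    lift l₂ to ℕ using not_lt.1 h2
    have : l₂ < j := by omega
    rw [Ring.choose_natCast, Nat.choose_eq_zero_of_lt this]
    simp
  · rfl

lemma hasSum_mulTerm (a b : ℤ → ℕ → K) (i : (ℤ × ℕ) × (ℤ × ℕ)) :
    HasSum (fun j : ℕ => mulTerm a b (i, j) • monoOp K (mulExp (i, j)).1 (mulExp (i, j)).2)
      ((a i.1.1 i.1.2 • monoOp K i.1.1 i.1.2) * (b i.2.1 i.2.2 • monoOp K i.2.1 i.2.2)) := by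
  have e : (a i.1.1 i.1.2 • monoOp K i.1.1 i.1.2) * (b i.2.1 i.2.2 • monoOp K i.2.1 i.2.2) =
      ∑ j ∈ Finset.range (i.1.2 + 1), mulTerm a b (i, j) •
        monoOp K (mulExp (i, j)).1 (mulExp (i, j)).2 := by
    rw [smul_mul_smul_comm, monoOp_mul, Finset.smul_sum]
    refine Finset.sum_congr rfl fun j hj => ?_
    have hj : j ≤ i.1.2 := by simpa [Nat.lt_succ_iff] using hj
    rw [smul_smul, mulTerm, if_pos hj]
    rfl
  rw [e]
  refine hasSum_sum_of_ne_finset_zero fun j hj => ?_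
  have hj : ¬ j ≤ i.1.2 := by simpa [Nat.lt_succ_iff] using hj
  rw [mulTerm, if_neg hj, zero_smul]

lemma summable_norm_smul {R I : Type*} [NormedAddCommGroup R] [NormedSpace K R] (D : I → R)
    (hD : ∀ i, ‖D i‖ ≤ 1) (t : I → K) (ht : Summable fun i => ‖t i‖) :
    Summable fun i => ‖t i • D i‖ := by
  refine Summable.of_nonneg_of_le (fun _ => norm_nonneg _) (fun i => ?_) ht
  rw [norm_smul]
  exact mul_le_of_le_one_right (norm_nonneg _) (hD i)

variable [CompleteSpace K]

lemma hasSum_mul_of_norm {R I : Type*} [NormedRing R] [CompleteSpace R] {f g : I → R} {S T : R}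
    (hS : HasSum f S) (hT : HasSum g T) (hf : Summable fun i => ‖f i‖)
    (hg : Summable fun i => ‖g i‖) : HasSum (fun i : I × I => f i.1 * g i.2) (S * T) :=
  hS.mul hT (summable_mul_of_summable_norm hf hg)

/-- Regrouping an absolutely convergent series along the fibres of a map of index sets. -/
lemma hasSum_regroup {R I J : Type*} [NormedAddCommGroup R] [NormedSpace K R]
    (D : I → R) (t : J → K) (ht : Summable fun q => ‖t q‖) (φ : J → I) {F : R}
    (hF : HasSum (fun q => t q • D (φ q)) F) :
    HasSum (fun i => (∑' q : φ ⁻¹' {i}, t q) • D i) F := by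
  rw [← (Equiv.sigmaFiberEquiv φ).hasSum_iff] at hF
  refine hF.sigma fun y => ?_
  have hy : Summable fun q : φ ⁻¹' {y} => t q := ht.of_norm.subtype _
  have := hy.hasSum.smul_const (D y)
  have e : (fun q : φ ⁻¹' {y} => t q • D y) =
      fun c => ((fun q => t q • D (φ q)) ∘ ⇑(Equiv.sigmaFiberEquiv φ)) ⟨y, c⟩ := by
    funext q
    have hq : φ q.1 = y := q.2
    change t q.1 • D y = t q.1 • D (φ q.1)
    rw [hq]
  rw [e] at this
  exact this

lemma summable_norm_coeff (hη : 0 < η) (h1 : η < 1)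
    (ha : ∀ l k, ‖a l k‖ < C * η ^ (l.natAbs + k)) :
    Summable fun i : ℤ × ℕ => ‖a i.1 i.2‖ :=
  Summable.of_nonneg_of_le (fun _ => norm_nonneg _) (fun i => (ha i.1 i.2).le)
    ((summable_pow_natAbs_add hη h1).mul_left C)

lemma hasSum_mulCoeff (ha : IsOverconvergentB a) (hb : IsOverconvergentB b)
    {S T : OpAlg K}
    (hS : HasSum (fun i : ℤ × ℕ => a i.1 i.2 • monoOp K i.1 i.2) S)
    (hT : HasSum (fun i : ℤ × ℕ => b i.1 i.2 • monoOp K i.1 i.2) T) :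
    HasSum (fun i : ℤ × ℕ => mulCoeff a b i.1 i.2 • monoOp K i.1 i.2) (S * T) := by
  obtain ⟨C, hC, η, h0, h1, h⟩ := ha
  obtain ⟨C', hC', η', h0', h1', h'⟩ := hb
  have e1 := IsOverconvergentB.mono_rate hC h0 (le_max_left η η') h
  have e2 := IsOverconvergentB.mono_rate hC' h0' (le_max_right η η') h'
  have m0 : 0 < max η η' := lt_max_of_lt_left h0
  have m1 := max_lt h1 h1'
  have hD : ∀ i : ℤ × ℕ, ‖monoOp K i.1 i.2‖ ≤ 1 := fun i => norm_monoOp_le K _ _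
  have s1 := summable_norm_smul (fun i : ℤ × ℕ => monoOp K i.1 i.2) hD
    (fun i : ℤ × ℕ => a i.1 i.2) (summable_norm_coeff m0 m1 e1)
  have s2 := summable_norm_smul (fun i : ℤ × ℕ => monoOp K i.1 i.2) hD
    (fun i : ℤ × ℕ => b i.1 i.2) (summable_norm_coeff m0 m1 e2)
  have hST := hasSum_mul_of_norm hS hT s1 s2
  have ht := summable_norm_mulTerm hC hC' m0 m1 e1 e2
  have hf : Summable fun q : MulIndex => mulTerm a b q • monoOp K (mulExp q).1 (mulExp q).2 :=
    (summable_norm_smul (fun q : MulIndex => monoOp K (mulExp q).1 (mulExp q).2)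
      (fun q => hD (mulExp q)) _ ht).of_norm
  obtain ⟨F, hF⟩ := hf
  have hF' : HasSum (fun i : (ℤ × ℕ) × (ℤ × ℕ) =>
      (a i.1.1 i.1.2 • monoOp K i.1.1 i.1.2) * (b i.2.1 i.2.2 • monoOp K i.2.1 i.2.2)) F :=
    HasSum.prod_fiberwise hF (hasSum_mulTerm a b)
  have hFe : S * T = F := hST.unique hF'
  rw [hFe]
  exact hasSum_regroup (fun i : ℤ × ℕ => monoOp K i.1 i.2) (mulTerm a b) ht mulExp hF

end Bounds

variable {K} in
/-- A series with a single nonzero coefficient. -/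
def singleCoeff (l : ℤ) (k : ℕ) (c : K) : ℤ → ℕ → K := fun l' k' => if (l', k') = (l, k) then c else 0

variable {K} in
lemma isOverconvergentB_singleCoeff (l : ℤ) (k : ℕ) (c : K) :
    IsOverconvergentB (singleCoeff l k c) := by
  refine ⟨(‖c‖ + 1) * 2 ^ (l.natAbs + k), by positivity, 1 / 2, by norm_num, by norm_num,
    fun l' k' => ?_⟩
  unfold singleCoeff
  split_ifs with h
  · obtain ⟨rfl, rfl⟩ := Prod.mk.inj h
    rw [mul_assoc, ← mul_pow]
    norm_num
  · rw [norm_zero]; positivity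

lemma hasSum_singleCoeff (l : ℤ) (k : ℕ) (c : K) :
    HasSum (fun i : ℤ × ℕ => singleCoeff l k c i.1 i.2 • monoOp K i.1 i.2)
      (c • monoOp K l k) := by
  have h := hasSum_single (f := fun i : ℤ × ℕ => singleCoeff l k c i.1 i.2 • monoOp K i.1 i.2)
    (l, k) (fun i hi => by
      have : ¬ (i.1, i.2) = (l, k) := hi
      simp [singleCoeff, this])
  have e : singleCoeff l k c l k = c := by simp [singleCoeff]
  simpa only [e] using h

lemma singleCoeff_of_neg (l : ℕ) (k : ℕ) (c : K) (l' : ℤ) (k' : ℕ) (h : l' < 0) :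
    singleCoeff (l : ℤ) k c l' k' = 0 := by
  have : ¬ (l', k') = ((l : ℤ), k) := by
    intro e
    have := (Prod.mk.inj e).1
    omega
  simp only [singleCoeff, if_neg this]

/-- Series indexed by `ℕ × ℕ` are the series indexed by `ℤ × ℕ` without negative powers of `x`. -/
lemma exists_natSeries_iff (T : OpAlg K) :
    (∃ a : ℕ → ℕ → K, IsOverconvergentA a ∧
      HasSum (fun i : ℕ × ℕ => a i.1 i.2 • monoOp K (i.1 : ℤ) i.2) T) ↔
    ∃ b : ℤ → ℕ → K, IsOverconvergentB b ∧ (∀ l k, l < 0 → b l k = 0) ∧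
      HasSum (fun i : ℤ × ℕ => b i.1 i.2 • monoOp K i.1 i.2) T := by
  have hinj : Function.Injective (fun i : ℕ × ℕ => ((i.1 : ℤ), i.2)) := fun i j h => by
    have := Prod.mk.inj h
    exact Prod.ext (by exact_mod_cast this.1) this.2
  have hsum : ∀ b : ℤ → ℕ → K, (∀ l k, l < 0 → b l k = 0) →
      (HasSum (fun i : ℕ × ℕ => b i.1 i.2 • monoOp K (i.1 : ℤ) i.2) T ↔
        HasSum (fun i : ℤ × ℕ => b i.1 i.2 • monoOp K i.1 i.2) T) := fun b hb => by
    refine hinj.hasSum_iff (f := fun i : ℤ × ℕ => b i.1 i.2 • monoOp K i.1 i.2) ?_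
    rintro ⟨l, k⟩ h
    have : l < 0 := by
      by_contra hl
      lift l to ℕ using not_lt.1 hl
      exact h ⟨(l, k), rfl⟩
    simp only [hb l k this, zero_smul]
  constructor
  · rintro ⟨a, ⟨C, hC, η, h0, h1, h⟩, hT⟩
    set b : ℤ → ℕ → K := fun l k => if 0 ≤ l then a l.toNat k else 0 with hbdef
    have hneg : ∀ l k, l < 0 → b l k = 0 := fun l k hl => if_neg (not_le.2 hl)
    have hpos : ∀ (l k : ℕ), b (l : ℤ) k = a l k := fun l k => by
      simp [hbdef]
    refine ⟨b, ⟨C, hC, η, h0, h1, fun l k => ?_⟩, hneg, (hsum b hneg).1 ?_⟩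
    · by_cases hl : 0 ≤ l
      · lift l to ℕ using hl
        rw [hpos]
        exact h l k
      · rw [hneg l k (not_le.1 hl), norm_zero]
        positivity
    · simpa only [hpos] using hT
  · rintro ⟨b, ⟨C, hC, η, h0, h1, h⟩, hb, hT⟩
    exact ⟨fun l k => b l k, ⟨C, hC, η, h0, h1, fun l k => h l k⟩, (hsum b hb).2 hT⟩

/-- The monomial `xⁿ`. -/
def xPow (n : ℤ) : BoundedLaurent K :=
  BoundedLaurent.ofBounded (fun r => if r = n then 1 else 0) 1
    (fun r => by split_ifs <;> simp)

variable {K}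

/-- The matrix coefficients of an operator given by a series. -/
lemma sum_coeff_mul_choose {a : ℤ → ℕ → K} {T : OpAlg K}
    (ha : HasSum (fun i : ℤ × ℕ => a i.1 i.2 • monoOp K i.1 i.2) T) (n : ℕ) (d : ℤ) :
    ∑ k ∈ Finset.range (n + 1), a (d + k) k * (n.choose k : K) =
      (T.apply (xPow K n)).coeff (n + d) := by
  have h := ha.mapL (OpAlg.coeffL (xPow K n) (n + d))
  have hinj : Function.Injective (fun k : ℕ => (d + (k : ℤ), k)) := fun i j hij =>
    (Prod.mk.inj hij).2
  have hterm : ∀ (l : ℤ) (k : ℕ), OpAlg.coeffL (xPow K n) (n + d) (a l k • monoOp K l k) =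
      if l = d + k then a (d + k) k * (n.choose k : K) else 0 := by
    intro l k
    rw [map_smul, OpAlg.coeffL_apply, monoOp_apply, xPow, BoundedLaurent.coeff_ofBounded,
      smul_eq_mul]
    by_cases hl : l = d + k
    · subst hl
      rw [if_pos rfl, if_pos (by ring), show (n : ℤ) + d - (d + k) + k = n by ring,
        Ring.choose_natCast]
      simp
    · rw [if_neg hl, if_neg (fun e => hl (by linarith))]
      simp
  simp only [hterm] at h
  rw [← hinj.hasSum_iff] at h
  · have h' : HasSum (fun k : ℕ => a (d + k) k * (n.choose k : K))
        ((T.apply (xPow K n)).coeff (n + d)) := by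
      simpa [Function.comp_def, OpAlg.coeffL_apply] using h
    refine (hasSum_sum_of_ne_finset_zero fun k hk => ?_).unique h'
    rw [Nat.choose_eq_zero_of_lt (by simpa using hk)]
    simp
  · rintro ⟨l, k⟩ hlk
    exact if_neg fun e : l = d + k => hlk ⟨k, by rw [e]⟩

/-- An operator is given by at most one coefficient array, so that the elements of the rings
`A₁(K)†` and `B₁(K)†` below are the formal series themselves. -/
theorem coeff_unique {a b : ℤ → ℕ → K} {T : OpAlg K}
    (ha : HasSum (fun i : ℤ × ℕ => a i.1 i.2 • monoOp K i.1 i.2) T)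
    (hb : HasSum (fun i : ℤ × ℕ => b i.1 i.2 • monoOp K i.1 i.2) T) : a = b := by
  have key : ∀ (k : ℕ) (d : ℤ), a (d + k) k = b (d + k) k := by
    intro k d
    induction k using Nat.strong_induction_on with
    | _ k ih =>
      have h := (sum_coeff_mul_choose ha k d).trans (sum_coeff_mul_choose hb k d).symm
      rw [Finset.sum_range_succ, Finset.sum_range_succ, Nat.choose_self, Nat.cast_one, mul_one,
        mul_one, Finset.sum_congr rfl fun i hi => by rw [ih i (Finset.mem_range.1 hi)]] at h
      exact add_left_cancel h
  funext l k
  simpa using key k (l - k)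

variable (K)

variable [CompleteSpace K]

/-- The ring `B₁(K)†` of the series `∑_{l ∈ ℤ, k ∈ ℕ} a_{l,k} x ^ l ∂^[k]` with
`|a_{l,k}| < C η ^ (max (l, -l) + k)` for some `C > 0` and `η < 1`. -/
def B1 : Subalgebra K (OpAlg K) where
  carrier := {T | ∃ a : ℤ → ℕ → K, IsOverconvergentB a ∧
    HasSum (fun i : ℤ × ℕ => a i.1 i.2 • monoOp K i.1 i.2) T}
  mul_mem' := by
    rintro S T ⟨a, ha, hS⟩ ⟨b, hb, hT⟩
    exact ⟨mulCoeff a b, isOverconvergentB_mulCoeff ha hb, hasSum_mulCoeff ha hb hS hT⟩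
  add_mem' := by
    rintro S T ⟨a, ha, hS⟩ ⟨b, hb, hT⟩
    exact ⟨_, ha.add hb, by simpa only [add_smul] using hS.add hT⟩
  algebraMap_mem' := fun c => ⟨singleCoeff 0 0 c, isOverconvergentB_singleCoeff 0 0 c, by
    have := hasSum_singleCoeff K 0 0 c
    rwa [monoOp_zero_zero, ← Algebra.algebraMap_eq_smul_one] at this⟩

/-- The ring `A₁(K)†` of the series `∑_{l, k ∈ ℕ} a_{l,k} x ^ l ∂^[k]` with
`|a_{l,k}| < C η ^ (l + k)` for some `C > 0` and `η < 1`. -/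
def A1 : Subalgebra K (OpAlg K) where
  carrier := {T | ∃ a : ℕ → ℕ → K, IsOverconvergentA a ∧
    HasSum (fun i : ℕ × ℕ => a i.1 i.2 • monoOp K (i.1 : ℤ) i.2) T}
  mul_mem' := by
    intro S T hS hT
    obtain ⟨a, ha, ha', hS⟩ := (exists_natSeries_iff K S).1 hS
    obtain ⟨b, hb, hb', hT⟩ := (exists_natSeries_iff K T).1 hT
    exact (exists_natSeries_iff K _).2 ⟨mulCoeff a b, isOverconvergentB_mulCoeff ha hb,
      mulCoeff_of_neg ha' hb', hasSum_mulCoeff ha hb hS hT⟩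
  add_mem' := by
    intro S T hS hT
    obtain ⟨a, ha, ha', hS⟩ := (exists_natSeries_iff K S).1 hS
    obtain ⟨b, hb, hb', hT⟩ := (exists_natSeries_iff K T).1 hT
    exact (exists_natSeries_iff K _).2 ⟨_, ha.add hb,
      fun l k hl => by rw [ha' l k hl, hb' l k hl, add_zero],
      by simpa only [add_smul] using hS.add hT⟩
  algebraMap_mem' := fun c => (exists_natSeries_iff K _).2
    ⟨singleCoeff 0 0 c, isOverconvergentB_singleCoeff 0 0 c,
      fun l k hl => singleCoeff_of_neg K 0 0 c l k hl, by
      have := hasSum_singleCoeff K 0 0 c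
      rwa [monoOp_zero_zero, ← Algebra.algebraMap_eq_smul_one] at this⟩

lemma A1_le_B1 : A1 K ≤ B1 K := fun T hT => by
  obtain ⟨b, hb, _, h⟩ := (exists_natSeries_iff K T).1 hT
  exact ⟨b, hb, h⟩

/-- The inclusion of `A₁(K)†` in `B₁(K)†`. -/
def incl : A1 K →+* B1 K := (Subalgebra.inclusion (A1_le_B1 K)).toRingHom

lemma monoOp_mem_A1 (l k : ℕ) : monoOp K (l : ℤ) k ∈ A1 K :=
  (exists_natSeries_iff K _).2 ⟨singleCoeff l k 1, isOverconvergentB_singleCoeff l k 1,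
    fun l' k' h => singleCoeff_of_neg K l k 1 l' k' h, by
      simpa only [one_smul] using hasSum_singleCoeff K l k 1⟩

/-- The coordinate `x` in `A₁(K)†`. -/
def A1.x : A1 K := ⟨monoOp K 1 0, monoOp_mem_A1 K 1 0⟩

/-- The derivation `∂` in `A₁(K)†`. -/
def A1.d : A1 K := ⟨monoOp K 0 1, monoOp_mem_A1 K 0 1⟩

/-- The coordinate `x` in `B₁(K)†`. -/
def B1.x : B1 K := incl K (A1.x K)

/-- The derivation `∂` in `B₁(K)†`. -/
def B1.d : B1 K := incl K (A1.d K)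

end Operators

section Hypergeometric

/-- `∏ᵢ (x∂ - αᵢ) - (-1) ^ (m + n p) π ^ (m - n) x ∏ⱼ (x∂ - βⱼ)` in a `K`-algebra with two given
elements `x` and `d = ∂`.  The exponent `m - n` is an integer, possibly negative. -/
def hypOp {K R : Type*} [Field K] [Ring R] [Algebra K R] (x d : R) (p : ℕ) (π : K) {m n : ℕ}
    (α : Fin m → K) (β : Fin n → K) : R :=
  (List.ofFn fun i => x * d - algebraMap K R (α i)).prod -
    algebraMap K R ((-1) ^ (m + n * p) * π ^ ((m : ℤ) - (n : ℤ))) * x *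
      (List.ofFn fun j => x * d - algebraMap K R (β j)).prod

variable (K : Type*) [NontriviallyNormedField K] [IsUltrametricDist K] [CompleteSpace K]

/-- The left `A₁(K)†`-module `A₁(K)† / A₁(K)† Hyp_π(α; β)`. -/
abbrev HypModA (p : ℕ) (π : K) {m n : ℕ} (α : Fin m → K) (β : Fin n → K) : Type _ :=
  A1 K ⧸ Submodule.span (A1 K) {hypOp (A1.x K) (A1.d K) p π α β}

/-- The left `B₁(K)†`-module `H_π(α; β) = B₁(K)† / B₁(K)† Hyp_π(α; β)`. -/
abbrev HypModB (p : ℕ) (π : K) {m n : ℕ} (α : Fin m → K) (β : Fin n → K) : Type _ :=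
  B1 K ⧸ Submodule.span (B1 K) {hypOp (B1.x K) (B1.d K) p π α β}

end Hypergeometric

section BaseChange

open scoped TensorProduct

variable {A B : Type*} [Ring A] [Ring B] (f : A →+* B)

section Extend

variable (M : Type*) [AddCommGroup M] [Module A M]

/-- The relations `b f(a) ⊗ m = b ⊗ a m`. -/
def balancedRelations : Submodule B (B ⊗[ℤ] M) :=
  Submodule.span B {t | ∃ (b : B) (a : A) (v : M), t = (b * f a) ⊗ₜ[ℤ] v - b ⊗ₜ[ℤ] (a • v)}

/-- Extension of scalars `B ⊗_A M` of a left module along a homomorphism `f : A → B` of not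
necessarily commutative rings, as a left `B`-module. -/
abbrev ExtendScalars : Type _ := (B ⊗[ℤ] M) ⧸ balancedRelations f M

end Extend

/-- The restriction of scalars along `f : A → B` of a left `B`-module `N`. -/
def RestrictAlong (_f : A →+* B) (N : Type*) : Type _ := N

section Restrict

variable (N : Type*) [AddCommGroup N] [Module B N]

instance : AddCommGroup (RestrictAlong f N) := inferInstanceAs (AddCommGroup N)

instance : Module A (RestrictAlong f N) :=
  letI : Module B (RestrictAlong f N) := inferInstanceAs (Module B N)
  Module.compHom (RestrictAlong f N) f

lemma RestrictAlong.smul_def (a : A) (v : N) :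
    (a • (show RestrictAlong f N from v) : RestrictAlong f N) = (f a • v : N) := rfl

end Restrict

/-- The natural morphism `M → B ⊗_A M`, `v ↦ 1 ⊗ v`, of left `A`-modules. -/
def extendUnit (M : Type*) [AddCommGroup M] [Module A M] :
    M →ₗ[A] RestrictAlong f (ExtendScalars f M) where
  toFun v := (balancedRelations f M).mkQ ((1 : B) ⊗ₜ[ℤ] v)
  map_add' v w := by
    rw [TensorProduct.tmul_add, map_add]
    rfl
  map_smul' a v := by
    change _ = f a • (balancedRelations f M).mkQ ((1 : B) ⊗ₜ[ℤ] v)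
    rw [← map_smul, TensorProduct.smul_tmul', smul_eq_mul, mul_one, eq_comm, ← sub_eq_zero,
      ← map_sub, ← LinearMap.mem_ker, Submodule.ker_mkQ]
    exact Submodule.subset_span ⟨1, a, v, by rw [one_mul]⟩

end BaseChange

section Functors

variable (K : Type*) [NontriviallyNormedField K] [IsUltrametricDist K] [CompleteSpace K]

/-- `j^* M = B₁(K)† ⊗_{A₁(K)†} M`: restriction from the affine line to `𝔾ₘ`. -/
abbrev JPullback (M : Type*) [AddCommGroup M] [Module (A1 K) M] : Type _ :=
  ExtendScalars (incl K) M

/-- `j_+ N`: the `B₁(K)†`-module `N` regarded as an `A₁(K)†`-module. -/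
abbrev JPushforward (N : Type*) : Type _ := RestrictAlong (incl K) N

/-- The natural morphism `M → j_+ j^* M`. -/
abbrev jUnit (M : Type*) [AddCommGroup M] [Module (A1 K) M] :
    M →ₗ[A1 K] JPushforward K (JPullback K M) :=
  extendUnit (incl K) M

end Functors

section Integers

variable (K : Type*) [NontriviallyNormedField K] [IsUltrametricDist K]

/-- The valuation ring `V = {x ∈ K | ‖x‖ ≤ 1}` of `K`. -/
abbrev valRing : ValuationSubring K := (NormedField.valuation (K := K)).valuationSubring

lemma mem_valRing (x : K) : x ∈ valRing K ↔ ‖x‖ ≤ 1 := by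
  rw [Valuation.mem_valuationSubring_iff]
  exact Iff.rfl

end Integers

section Liouville

open Classical in
/-- `α ∈ ℤ_p` is a `p`-adic Liouville number if one of the two power series
`∑_{k ≥ 0, k ≠ α} t ^ k / (α - k)` and `∑_{k ≥ 0, k ≠ -α} t ^ k / (α + k)` has radius of
convergence less than `1`. -/
def IsPadicLiouville (p : ℕ) [Fact p.Prime] (α : ℤ_[p]) : Prop :=
  (FormalMultilinearSeries.ofScalars ℚ_[p] fun k : ℕ =>
    if (k : ℤ_[p]) = α then (0 : ℚ_[p]) else 1 / ((α : ℚ_[p]) - k)).radius < 1 ∨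
  (FormalMultilinearSeries.ofScalars ℚ_[p] fun k : ℕ =>
    if (k : ℤ_[p]) = -α then (0 : ℚ_[p]) else 1 / ((α : ℚ_[p]) + k)).radius < 1

/-- The image in `K` of a finite sequence of `p`-adic integers. -/
def toField (p : ℕ) [Fact p.Prime] (K : Type*) [NontriviallyNormedField K] [NormedAlgebra ℚ_[p] K]
    {m : ℕ} (α : Fin m → ℤ_[p]) : Fin m → K :=
  fun i => algebraMap ℚ_[p] K (α i : ℚ_[p])

end Liouville

end ArithD

end

/-!
Everything rests on one fact: right multiplication by `H = Hyp_π(α; β)` is bijective on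
`B₁(K)† / A₁(K)†`.  By the snake lemma it makes `A₁(K)† / A₁(K)† H → B₁(K)† / B₁(K)† H`
bijective (`cyclicMap_bijective`).  Since `B ⊗_A A / A h = B / B f(h)` for any homomorphism
`f : A → B` (`extendCyclicEquiv`), this map is the morphism `M → j_+ j^* M`; and `x` acts bijectively
on `M` because it is a unit of `B₁(K)†`.

An element `T` of `B₁(K)†` maps `x ^ k`, `k ≥ 0`, to a Laurent series, whose coefficients of
`x ^ (-1 - l)`, `l ≥ 0`, form an array `principalPart T l k`.  This array vanishes if and only if `T`
lies in `A₁(K)†` (`mem_A1_iff_principalPart_eq_zero`), and binomial inversion shows that the arrays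
so obtained are all those bounded by some `C η ^ (l + k)` with `η < 1`
(`exists_norm_principalPart_le`, `exists_principalPart_eq`).  As
`H x ^ k = P(k) x ^ k - Q(k) x ^ (k + 1)` with `P(k) = ∏ᵢ (k - αᵢ)`,
`Q(k) = c ∏ⱼ (k - βⱼ)` and `|c| = |π| ^ (m - n)`, right multiplication by `H` becomes
the operator `f ↦ P(k) f(l, k) - Q(k) f(l, k + 1)`.  The `αᵢ` are not integers, so it has the formal inverse
`f(l, k) = ∑ₛ (∏_{r < s} Q(k + r) / ∏_{r ≤ s} P(k + r)) e(l, k + s)`,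
and the matter is whether these weights grow subexponentially.  Up to factors linear in `s`, both
`s!` and `π ^ s` have the same absolute value; `∏_{r < s} (k + r - β)` is divisible by `s!`; and
`s! / ∏_{r ≤ s} (k + r - α)` is an iterated difference of `1 / (k - α)`, which grows
subexponentially because `α` is not a Liouville number (`isSubexponential_resolvent`).
-/

noncomputable section

namespace ArithD

open scoped TensorProduct Nat

/-! ### Base change of cyclic modules -/

section CyclicModules

variable {A B : Type*} [Ring A] [Ring B] (f : A →+* B)

/-- The `B`-linear map `B ⊗_A M → N`, `b ⊗ v ↦ b g(v)`, attached to an `f`-semilinear map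
`g : M → N`. -/
def extendLift {M N : Type*} [AddCommGroup M] [Module A M] [AddCommGroup N] [Module B N]
    (g : M →ₛₗ[f] N) : ExtendScalars f M →ₗ[B] N :=
  Submodule.liftQ _
    (TensorProduct.AlgebraTensorModule.lift
      (LinearMap.toSpanSingleton B (M →ₗ[ℤ] N) g.toAddMonoidHom.toIntLinearMap))
    (Submodule.span_le.2 (by
      rintro _ ⟨b, a, v, rfl⟩
      simp [mul_smul]))

lemma extendLift_mk_tmul {M N : Type*} [AddCommGroup M] [Module A M] [AddCommGroup N] [Module B N]
    (g : M →ₛₗ[f] N) (b : B) (v : M) :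
    extendLift f g ((balancedRelations f M).mkQ (b ⊗ₜ[ℤ] v)) = b • g v :=
  rfl

lemma mk_tmul_smul {M : Type*} [AddCommGroup M] [Module A M] (b : B) (a : A) (v : M) :
    (balancedRelations f M).mkQ (b ⊗ₜ[ℤ] (a • v)) =
      (balancedRelations f M).mkQ ((b * f a) ⊗ₜ[ℤ] v) := by
  rw [eq_comm, ← sub_eq_zero, ← map_sub, ← LinearMap.mem_ker, Submodule.ker_mkQ]
  exact Submodule.subset_span ⟨b, a, v, rfl⟩

/-- The map `A / A h → B / B f(h)` induced by `f`. -/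
def cyclicMap (h : A) :
    (A ⧸ Submodule.span A {h}) →ₛₗ[f] (B ⧸ Submodule.span B {f h}) :=
  Submodule.mapQ _ _ f.toSemilinearMap (Submodule.span_le.2 (by
    rintro _ rfl
    exact Submodule.subset_span rfl))

lemma cyclicMap_mk (h a : A) :
    cyclicMap f h (Submodule.Quotient.mk a) = Submodule.Quotient.mk (f a) := rfl

/-- The isomorphism `B ⊗_A (A / A h) ≃ B / B f(h)`. -/
def extendCyclicEquiv (h : A) :
    ExtendScalars f (A ⧸ Submodule.span A {h}) ≃ₗ[B] B ⧸ Submodule.span B {f h} :=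
  LinearEquiv.ofLinearMap (extendLift f (cyclicMap f h))
    (Submodule.liftQ _
      (LinearMap.toSpanSingleton B (ExtendScalars f (A ⧸ Submodule.span A {h}))
        ((balancedRelations f _).mkQ ((1 : B) ⊗ₜ[ℤ] Submodule.Quotient.mk 1)))
      (Submodule.span_le.2 (by
        rintro _ rfl
        have e : (h • Submodule.Quotient.mk 1 : A ⧸ Submodule.span A {h}) = 0 := by
          rw [← Submodule.Quotient.mk_smul, Submodule.Quotient.mk_eq_zero, smul_eq_mul, mul_one]
          exact Submodule.subset_span rfl
        have := mk_tmul_smul f (1 : B) h (Submodule.Quotient.mk 1 : A ⧸ Submodule.span A {h})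
        rw [e, TensorProduct.tmul_zero, map_zero, one_mul] at this
        rw [SetLike.mem_coe, LinearMap.mem_ker, LinearMap.toSpanSingleton_apply, ← map_smul,
          TensorProduct.smul_tmul', smul_eq_mul, mul_one]
        exact this.symm)))
    (by
      ext
      simp only [LinearMap.comp_apply, Submodule.mkQ_apply, Submodule.liftQ_apply,
        LinearMap.toSpanSingleton_apply, one_smul, LinearMap.id_apply]
      rw [← Submodule.mkQ_apply (balancedRelations f _), extendLift_mk_tmul, one_smul,
        cyclicMap_mk, map_one])
    (by
      refine Submodule.linearMap_qext _ (LinearMap.ext fun t => ?_)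
      induction t with
      | zero => simp only [map_zero]
      | add s t hs ht => simp only [map_add, hs, ht]
      | tmul b v =>
        obtain ⟨a, rfl⟩ := Submodule.Quotient.mk_surjective _ v
        rw [LinearMap.comp_apply, LinearMap.comp_apply, extendLift_mk_tmul, cyclicMap_mk, map_smul,
          Submodule.liftQ_apply, LinearMap.toSpanSingleton_apply, ← map_smul, ← map_smul,
          TensorProduct.smul_tmul', TensorProduct.smul_tmul', smul_eq_mul, smul_eq_mul, mul_one,
          ← mk_tmul_smul, ← Submodule.Quotient.mk_smul, smul_eq_mul, mul_one]
        rfl)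

lemma extendCyclicEquiv_extendUnit (h : A) (v : A ⧸ Submodule.span A {h}) :
    extendCyclicEquiv f h (extendUnit f _ v) = cyclicMap f h v :=
  (extendLift_mk_tmul f (cyclicMap f h) 1 v).trans (one_smul _ _)

/-- The map `A / A h → B / B f(h)` is an isomorphism as soon as right multiplication by `h` is a
bijection of `B / A`. -/
lemma cyclicMap_bijective (hf : Function.Injective f) (h : A)
    (hinj : ∀ b : B, b * f h ∈ f.range → b ∈ f.range)
    (hsurj : ∀ b : B, ∃ u : B, b - u * f h ∈ f.range) :
    Function.Bijective (cyclicMap f h) := by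
  constructor
  · rw [injective_iff_map_eq_zero]
    intro v hv
    obtain ⟨a, rfl⟩ := Submodule.Quotient.mk_surjective _ v
    rw [cyclicMap_mk, Submodule.Quotient.mk_eq_zero, Submodule.mem_span_singleton] at hv
    obtain ⟨b, hb⟩ := hv
    obtain ⟨a', rfl⟩ := hinj b ⟨a, hb.symm⟩
    rw [Submodule.Quotient.mk_eq_zero, Submodule.mem_span_singleton]
    exact ⟨a', hf (by rw [← hb, smul_eq_mul, smul_eq_mul, map_mul])⟩
  · intro w
    obtain ⟨b, rfl⟩ := Submodule.Quotient.mk_surjective _ w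
    obtain ⟨u, a, ha⟩ := hsurj b
    refine ⟨Submodule.Quotient.mk a, ?_⟩
    rw [cyclicMap_mk, ha, Submodule.Quotient.eq, sub_sub_cancel_left, neg_mem_iff,
      Submodule.mem_span_singleton]
    exact ⟨u, rfl⟩

end CyclicModules

/-! ### Principal parts of overconvergent operators -/

section PrincipalParts

variable {K : Type*} [NontriviallyNormedField K]

/-- The coefficient of `x ^ (-1 - l)` in `T x ^ k`.  For fixed `T` these numbers, with
`l, k ≥ 0`, form the matrix of the map `K[x] → K[x, x⁻¹] / K[x]` given by `T`. -/
def principalPart (T : OpAlg K) (l k : ℕ) : K := (T.apply (xPow K k)).coeff (-1 - l)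

lemma principalPart_sub (S T : OpAlg K) (l k : ℕ) :
    principalPart (S - T) l k = principalPart S l k - principalPart T l k :=
  map_sub (OpAlg.coeffL (xPow K k) (-1 - l)) S T

variable [IsUltrametricDist K]

lemma principalPart_eq_sum {a : ℤ → ℕ → K} {T : OpAlg K}
    (ha : HasSum (fun i : ℤ × ℕ => a i.1 i.2 • monoOp K i.1 i.2) T) (l n : ℕ) :
    principalPart T l n =
      ∑ k ∈ Finset.range (n + 1), a (-1 - l - n + k) k * (n.choose k : K) := by
  rw [sum_coeff_mul_choose ha, principalPart]
  congr 1
  ring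

lemma exists_hasSum_of_isOverconvergentB [CompleteSpace K] {a : ℤ → ℕ → K}
    (ha : IsOverconvergentB a) :
    ∃ T ∈ B1 K, HasSum (fun i : ℤ × ℕ => a i.1 i.2 • monoOp K i.1 i.2) T := by
  have ha' := ha
  obtain ⟨C, hC, η, h0, h1, h⟩ := ha
  obtain ⟨T, hT⟩ := (summable_norm_smul (fun i : ℤ × ℕ => monoOp K i.1 i.2)
    (fun i => norm_monoOp_le K _ _) (fun i : ℤ × ℕ => a i.1 i.2)
    (summable_norm_coeff h0 h1 h)).of_norm
  exact ⟨T, ⟨a, ha', hT⟩, hT⟩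

/-- An operator of `B₁(K)†` lies in `A₁(K)†` if and only if it maps polynomials to
polynomials. -/
lemma mem_A1_iff_principalPart_eq_zero [CompleteSpace K] {T : OpAlg K} (hT : T ∈ B1 K) :
    T ∈ A1 K ↔ ∀ l k, principalPart T l k = 0 := by
  constructor
  · intro hA l k
    obtain ⟨b, -, hb, h⟩ := (exists_natSeries_iff K T).1 hA
    rw [principalPart_eq_sum h]
    refine Finset.sum_eq_zero fun j hj => ?_
    rw [Finset.mem_range] at hj
    rw [hb _ _ (by omega), zero_mul]
  · intro h0
    obtain ⟨a, ha, hs⟩ := hT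
    refine (exists_natSeries_iff K T).2 ⟨a, ha, fun l k => ?_, hs⟩
    induction k using Nat.strong_induction_on generalizing l with
    | _ k ih =>
      intro hl
      obtain ⟨l', rfl⟩ : ∃ l' : ℕ, l = -1 - l' := ⟨(-1 - l).toNat, by omega⟩
      have h := h0 l' k
      rw [principalPart_eq_sum hs, Finset.sum_range_succ, Finset.sum_eq_zero, zero_add,
        Nat.choose_self, Nat.cast_one, mul_one] at h
      · rwa [show -1 - (l' : ℤ) - k + k = -1 - l' by ring] at h
      · intro j hj
        rw [Finset.mem_range] at hj
        rw [ih j hj _ (by omega), zero_mul]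

lemma exists_norm_principalPart_le [CompleteSpace K] {T : OpAlg K} (hT : T ∈ B1 K) :
    ∃ C : ℝ, 0 < C ∧ ∃ η : ℝ, 0 < η ∧ η < 1 ∧
      ∀ l k, ‖principalPart T l k‖ ≤ C * η ^ (l + k) := by
  obtain ⟨a, ⟨C, hC, η, h0, h1, h⟩, hs⟩ := hT
  refine ⟨C, hC, η, h0, h1, fun l n => ?_⟩
  rw [principalPart_eq_sum hs]
  refine IsUltrametricDist.norm_sum_le_of_forall_le_of_nonneg (by positivity) fun k hk => ?_
  rw [Finset.mem_range] at hk
  calc _ ≤ C * η ^ ((-1 - (l : ℤ) - n + k).natAbs + k) * 1 := by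
        rw [norm_mul]
        gcongr
        · exact (h _ _).le
        · exact IsUltrametricDist.norm_natCast_le_one K _
    _ ≤ _ := by
        rw [mul_one]
        exact mul_le_mul_of_nonneg_left (pow_le_pow_of_le_one h0.le h1.le (by omega)) hC.le

/-- Every array with geometric decay is the principal part of an operator of `B₁(K)†`.  The
coefficients of the operator are found by binomial inversion along the diagonals `l - k = d`. -/
lemma exists_principalPart_eq [CompleteSpace K] {e : ℕ → ℕ → K} {C η : ℝ} (hC : 0 < C)
    (h0 : 0 < η) (h1 : η < 1) (he : ∀ l k, ‖e l k‖ ≤ C * η ^ (l + k)) :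
    ∃ T ∈ B1 K, ∀ l k, principalPart T l k = e l k := by
  -- `toNat` is only reached at nonnegative arguments: on the diagonal `d = l - k` with `l < 0`, the
  -- differences of order `k` involve `j ≤ k` only.
  set g : ℤ → ℕ → K := fun d j => e (-1 - j - d).toNat j with hg
  set a : ℤ → ℕ → K := fun l k => if l < 0 then (fwdDiff (1 : ℕ))^[k] (g (l - k)) 0 else 0 with ha
  have hover : IsOverconvergentB a := by
    refine ⟨C * η⁻¹ + 1, by positivity, η, h0, h1, fun l k => ?_⟩
    suffices h : ‖a l k‖ ≤ C * η⁻¹ * η ^ (l.natAbs + k) by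
      have : 0 < η ^ (l.natAbs + k) := by positivity
      linarith
    simp only [ha]
    split_ifs with hl
    · obtain ⟨l', hl', e'⟩ : ∃ l' : ℕ, l = -1 - l' ∧ l.natAbs = l' + 1 :=
        ⟨(-1 - l).toNat, by omega, by omega⟩
      have : C * η⁻¹ * η ^ (l.natAbs + k) = C * η ^ (l' + k) := by
        rw [e', add_right_comm, pow_succ]
        field_simp
      rw [this, fwdDiff_iter_eq_sum_shift]
      refine IsUltrametricDist.norm_sum_le_of_forall_le_of_nonneg (by positivity) fun j hj => ?_
      rw [Finset.mem_range] at hj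
      rw [zsmul_eq_mul, norm_mul]
      have hb : ‖g (l - k) (0 + j • 1)‖ ≤ C * η ^ (l' + k) := by
        refine (he _ _).trans_eq ?_
        congr 2
        simp only [smul_eq_mul, mul_one, zero_add]
        omega
      calc _ ≤ 1 * (C * η ^ (l' + k)) := by
            gcongr
            exact IsUltrametricDist.norm_intCast_le_one K _
        _ = _ := one_mul _
    · rw [norm_zero]; positivity
  obtain ⟨T, hT, hs⟩ := exists_hasSum_of_isOverconvergentB hover
  refine ⟨T, hT, fun l n => ?_⟩
  rw [principalPart_eq_sum hs]
  have h := shift_eq_sum_fwdDiff_iter (1 : ℕ) (g (-1 - l - n)) n 0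
  have e1 : g (-1 - l - n) (0 + n • 1) = e l n := by
    simp only [hg, smul_eq_mul, mul_one, zero_add]
    congr 1
    omega
  rw [← e1, h]
  refine Finset.sum_congr rfl fun k hk => ?_
  rw [Finset.mem_range] at hk
  rw [nsmul_eq_mul, mul_comm]
  simp only [ha]
  rw [if_pos (by omega), add_sub_cancel_right]

end PrincipalParts

/-! ### The action of the hypergeometric operator on monomials -/

section Action

lemma map_hypOp {K R S : Type*} [Field K] [Ring R] [Algebra K R] [Ring S] [Algebra K S]
    (f : R →ₐ[K] S) (x d : R) (p : ℕ) (π : K) {m n : ℕ} (α : Fin m → K) (β : Fin n → K) :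
    f (hypOp x d p π α β) = hypOp (f x) (f d) p π α β := by
  simp [hypOp, map_list_prod, List.map_ofFn, Function.comp_def]

variable {K : Type*} [NontriviallyNormedField K]

lemma OpAlg.apply_smul (T : OpAlg K) (c : K) (f : BoundedLaurent K) :
    T.apply (c • f) = c • T.apply f :=
  ContinuousLinearMap.map_smul (M₁ := BoundedLaurent K) (M₂ := BoundedLaurent K) T c f

lemma OpAlg.apply_sub (T : OpAlg K) (f g : BoundedLaurent K) :
    T.apply (f - g) = T.apply f - T.apply g :=
  ContinuousLinearMap.map_sub (M := BoundedLaurent K) (M₂ := BoundedLaurent K) T f g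

lemma OpAlg.sub_apply (S T : OpAlg K) (f : BoundedLaurent K) :
    (S - T).apply f = S.apply f - T.apply f := rfl

lemma OpAlg.algebraMap_apply (c : K) (f : BoundedLaurent K) :
    (algebraMap K (OpAlg K) c).apply f = c • f := by
  rw [Algebra.algebraMap_eq_smul_one]
  rfl

variable [IsUltrametricDist K]

lemma monoOp_apply_xPow (l : ℤ) (k : ℕ) (n : ℤ) :
    (monoOp K l k).apply (xPow K n) = ((Ring.choose n k : ℤ) : K) • xPow K (n - k + l) := by
  ext r
  rw [monoOp_apply, BoundedLaurent.coeff_smul, xPow, xPow, BoundedLaurent.coeff_ofBounded,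
    BoundedLaurent.coeff_ofBounded]
  by_cases h : r - l + k = n
  · rw [if_pos h, if_pos (by omega), h]
  · rw [if_neg h, if_neg (by omega), mul_zero, mul_zero]

lemma eulerFactor_apply_xPow (a : K) (n : ℤ) :
    (monoOp K 1 0 * monoOp K 0 1 - algebraMap K (OpAlg K) a).apply (xPow K n) =
      ((n : K) - a) • xPow K n := by
  rw [OpAlg.sub_apply, OpAlg.mul_apply, monoOp_apply_xPow, OpAlg.apply_smul, monoOp_apply_xPow,
    OpAlg.algebraMap_apply, Ring.choose_one_right, Ring.choose_zero_right, Int.cast_one, one_smul,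
    sub_smul]
  congr 3
  push_cast
  ring

lemma prod_eulerFactor_apply_xPow {m : ℕ} (α : Fin m → K) (n : ℤ) :
    (List.ofFn fun i => monoOp K 1 0 * monoOp K 0 1 - algebraMap K (OpAlg K) (α i)).prod.apply
      (xPow K n) = (∏ i, ((n : K) - α i)) • xPow K n := by
  induction m with
  | zero => simp
  | succ m ih =>
    rw [List.ofFn_succ, List.prod_cons, OpAlg.mul_apply, ih fun i => α i.succ, OpAlg.apply_smul,
      eulerFactor_apply_xPow, smul_smul, Fin.prod_univ_succ, mul_comm]

lemma hypOp_apply_xPow (p : ℕ) (π : K) {m n : ℕ} (α : Fin m → K) (β : Fin n → K) (k : ℤ) :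
    (hypOp (monoOp K 1 0) (monoOp K 0 1) p π α β).apply (xPow K k) =
      (∏ i, ((k : K) - α i)) • xPow K k -
        ((-1) ^ (m + n * p) * π ^ ((m : ℤ) - n) * ∏ j, ((k : K) - β j)) • xPow K (k + 1) := by
  rw [hypOp, OpAlg.sub_apply, OpAlg.mul_apply, OpAlg.mul_apply, prod_eulerFactor_apply_xPow,
    prod_eulerFactor_apply_xPow, OpAlg.apply_smul, OpAlg.apply_smul, OpAlg.algebraMap_apply,
    monoOp_apply_xPow, smul_smul, smul_smul, Ring.choose_zero_right, Int.cast_one, mul_one]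
  congr 2
  · ring
  · simp

lemma principalPart_mul_hypOp (T : OpAlg K) (p : ℕ) (π : K) {m n : ℕ} (α : Fin m → K)
    (β : Fin n → K) (l k : ℕ) :
    principalPart (T * hypOp (monoOp K 1 0) (monoOp K 0 1) p π α β) l k =
      (∏ i, ((k : K) - α i)) * principalPart T l k -
        ((-1) ^ (m + n * p) * π ^ ((m : ℤ) - n) * ∏ j, ((k : K) - β j)) *
          principalPart T l (k + 1) := by
  simp only [principalPart]
  rw [OpAlg.mul_apply, hypOp_apply_xPow, OpAlg.apply_sub, OpAlg.apply_smul, OpAlg.apply_smul]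
  push_cast
  rfl

end Action

/-! ### First-order recurrences with subexponential resolvent -/

section Recurrence

/-- A doubly indexed family of real numbers growing more slowly than `ρ ^ (k + s)` for every
`ρ > 1`. -/
def IsSubexponential (g : ℕ → ℕ → ℝ) : Prop :=
  ∀ ρ : ℝ, 1 < ρ → ∃ D : ℝ, 0 < D ∧ ∀ k s, g k s ≤ D * ρ ^ (k + s)

lemma IsSubexponential.mul {g h : ℕ → ℕ → ℝ} (hg : IsSubexponential g) (hh : IsSubexponential h)
    (h0 : ∀ k s, 0 ≤ h k s) : IsSubexponential fun k s => g k s * h k s := by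
  intro ρ hρ
  have h1 : 1 < Real.sqrt ρ := by rwa [Real.lt_sqrt zero_le_one, one_pow]
  obtain ⟨D, hD, hg⟩ := hg _ h1
  obtain ⟨E, hE, hh⟩ := hh _ h1
  refine ⟨D * E, by positivity, fun k s => ?_⟩
  calc g k s * h k s ≤ (D * Real.sqrt ρ ^ (k + s)) * (E * Real.sqrt ρ ^ (k + s)) :=
        mul_le_mul (hg k s) (hh k s) (h0 k s) (by positivity)
    _ = D * E * ρ ^ (k + s) := by
        rw [mul_mul_mul_comm, ← mul_pow, Real.mul_self_sqrt (by linarith)]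

lemma IsSubexponential.prod {ι : Type*} {g : ι → ℕ → ℕ → ℝ} (I : Finset ι)
    (hg : ∀ i, IsSubexponential (g i)) (h0 : ∀ i k s, 0 ≤ g i k s) :
    IsSubexponential fun k s => ∏ i ∈ I, g i k s := by
  classical
  induction I using Finset.induction_on with
  | empty =>
    intro ρ hρ
    refine ⟨1, one_pos, fun k s => ?_⟩
    simp only [Finset.prod_empty, one_mul]
    exact one_le_pow₀ hρ.le
  | insert i I hi ih =>
    simp only [Finset.prod_insert hi]
    exact (hg i).mul ih fun k s => Finset.prod_nonneg fun i _ => h0 i k s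

/-- A bound that is linear in `s` is subexponential: `1 + s (ρ - 1) ≤ ρ ^ s`. -/
lemma isSubexponential_linear {a : ℝ} (ha : 0 < a) :
    IsSubexponential fun _ s => a * (s + 1) := by
  intro ρ hρ
  have hr : 0 < ρ - 1 := sub_pos.2 hρ
  refine ⟨a * (1 + (ρ - 1)⁻¹), by positivity, fun k s => ?_⟩
  have h1 : 1 + (s : ℝ) * (ρ - 1) ≤ ρ ^ s := one_add_mul_sub_le_pow (by linarith) s
  have h2 : ρ ^ s ≤ ρ ^ (k + s) := pow_le_pow_right₀ hρ.le (Nat.le_add_left s k)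
  have h3 : 1 ≤ ρ ^ (k + s) := one_le_pow₀ hρ.le
  have h4 : (s : ℝ) ≤ (ρ - 1)⁻¹ * ρ ^ (k + s) := by
    rw [inv_mul_eq_div, le_div_iff₀ hr]
    linarith
  rw [mul_assoc]
  exact mul_le_mul_of_nonneg_left (by linarith) ha.le

variable {K : Type*} [NontriviallyNormedField K]

/-- The kernel `∏_{r < s} Q(k + r) / ∏_{r ≤ s} P(k + r)` of the inverse of the operator
`f ↦ P(k) f(k) - Q(k) f(k + 1)`. -/
def resolvent (P Q : ℕ → K) (k s : ℕ) : K :=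
  (∏ r ∈ Finset.range s, Q (k + r)) * (∏ r ∈ Finset.range (s + 1), P (k + r))⁻¹

variable {P Q : ℕ → K}

lemma mul_resolvent_zero (hP : ∀ k, P k ≠ 0) (k : ℕ) : P k * resolvent P Q k 0 = 1 := by
  simp [resolvent, hP k]

lemma mul_resolvent_succ (hP : ∀ k, P k ≠ 0) (k s : ℕ) :
    P k * resolvent P Q k (s + 1) = Q k * resolvent P Q (k + 1) s := by
  rw [resolvent, resolvent, Finset.prod_range_succ' _ s, Finset.prod_range_succ' _ (s + 1)]
  simp only [add_zero, ← add_assoc, add_right_comm k _ 1]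
  have := hP k
  rw [mul_inv]
  field_simp

lemma resolvent_succ_mul (hP : ∀ k, P k ≠ 0) (k s : ℕ) :
    resolvent P Q k (s + 1) * P (k + (s + 1)) = resolvent P Q k s * Q (k + s) := by
  rw [resolvent, resolvent, Finset.prod_range_succ _ s, Finset.prod_range_succ _ (s + 1), mul_inv]
  have := hP (k + (s + 1))
  field_simp

/-- Iterating the recurrence expresses `f k` through `f (k + s)`, whose geometric decay in `s` beats
the resolvent. -/
lemma eq_zero_of_recurrence (hP : ∀ k, P k ≠ 0) (hP1 : ∀ k, ‖P k‖ ≤ 1)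
    (hw : IsSubexponential fun k s => ‖resolvent P Q k s‖) {f : ℕ → K} {C η : ℝ}
    (h0 : 0 < η) (h1 : η < 1) (hf : ∀ k, ‖f k‖ ≤ C * η ^ k)
    (hrec : ∀ k, P k * f k - Q k * f (k + 1) = 0) (k : ℕ) : f k = 0 := by
  have iter : ∀ s, f k = resolvent P Q k s * P (k + s) * f (k + s) := by
    intro s
    induction s with
    | zero =>
      rw [add_zero, mul_comm (resolvent P Q k 0), mul_resolvent_zero hP, one_mul]
    | succ s ih =>
      rw [resolvent_succ_mul hP, ih, mul_assoc, sub_eq_zero.1 (hrec (k + s)), ← mul_assoc,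
        add_assoc]
  have hC : 0 ≤ C := by simpa using (norm_nonneg _).trans (hf 0)
  set θ := Real.sqrt η with hθ
  have t0 : 0 < θ := Real.sqrt_pos.2 h0
  have t1 : θ < 1 := by rw [hθ, Real.sqrt_lt' one_pos]; simpa using h1
  have tη : η = θ * θ := (Real.mul_self_sqrt h0.le).symm
  obtain ⟨D, hD, hw⟩ := hw θ⁻¹ ((one_lt_inv₀ t0).2 t1)
  have hle : ∀ s, ‖f k‖ ≤ D * C * θ ^ (k + s) := by
    intro s
    rw [iter s, norm_mul, norm_mul]
    calc _ ≤ (D * θ⁻¹ ^ (k + s)) * 1 * (C * η ^ (k + s)) := by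
          gcongr
          exacts [hw k s, hP1 _, hf _]
      _ = D * C * θ ^ (k + s) := by
          rw [mul_one, mul_mul_mul_comm, ← mul_pow, tη, inv_mul_cancel_left₀ t0.ne']
  have hlim : Filter.Tendsto (fun s => D * C * θ ^ (k + s)) Filter.atTop (nhds (D * C * 0)) := by
    refine Filter.Tendsto.const_mul _ ?_
    simp only [pow_add]
    simpa using (tendsto_pow_atTop_nhds_zero_of_lt_one t0.le t1).const_mul (θ ^ k)
  rw [mul_zero] at hlim
  exact norm_le_zero_iff.1 (ge_of_tendsto' hlim hle)

lemma exists_recurrence [CompleteSpace K] [IsUltrametricDist K] (hP : ∀ k, P k ≠ 0)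
    (hw : IsSubexponential fun k s => ‖resolvent P Q k s‖) {e : ℕ → ℕ → K} {C η : ℝ}
    (hC : 0 < C) (h0 : 0 < η) (h1 : η < 1) (he : ∀ l k, ‖e l k‖ ≤ C * η ^ (l + k)) :
    ∃ f : ℕ → ℕ → K, (∃ C' : ℝ, 0 < C' ∧ ∃ η' : ℝ, 0 < η' ∧ η' < 1 ∧
        ∀ l k, ‖f l k‖ ≤ C' * η' ^ (l + k)) ∧
      ∀ l k, P k * f l k - Q k * f l (k + 1) = e l k := by
  set θ := Real.sqrt η with hθ
  have t0 : 0 < θ := Real.sqrt_pos.2 h0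
  have t1 : θ < 1 := by rw [hθ, Real.sqrt_lt' one_pos]; simpa using h1
  have tη : η = θ * θ := (Real.mul_self_sqrt h0.le).symm
  obtain ⟨D, hD, hw⟩ := hw θ⁻¹ ((one_lt_inv₀ t0).2 t1)
  have hle : ∀ l k s, ‖resolvent P Q k s * e l (k + s)‖ ≤ D * C * θ ^ (l + k) * θ ^ s := by
    intro l k s
    rw [norm_mul]
    calc _ ≤ (D * θ⁻¹ ^ (k + s)) * (C * η ^ (l + (k + s))) := by
          gcongr
          exacts [hw k s, he _ _]
      _ = D * C * θ ^ (l + k) * θ ^ s * θ ^ l := by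
          rw [tη, mul_pow, inv_pow, pow_add θ l (k + s), pow_add θ l k, pow_add θ k s]
          field_simp
      _ ≤ D * C * θ ^ (l + k) * θ ^ s :=
          mul_le_of_le_one_right (by positivity) (pow_le_one₀ t0.le t1.le)
  have hsum : ∀ l k, Summable fun s => resolvent P Q k s * e l (k + s) := fun l k =>
    Summable.of_norm_bounded ((summable_geometric_of_lt_one t0.le t1).mul_left _) (hle l k)
  refine ⟨fun l k => ∑' s, resolvent P Q k s * e l (k + s),
    ⟨D * C, by positivity, θ, t0, t1, fun l k => ?_⟩, fun l k => ?_⟩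
  · refine IsUltrametricDist.norm_tsum_le_of_forall_le_of_nonneg (by positivity) fun s => ?_
    exact (hle l k s).trans (mul_le_of_le_one_right (by positivity) (pow_le_one₀ t0.le t1.le))
  · beta_reduce
    rw [(hsum l k).tsum_eq_zero_add, mul_add, ← mul_assoc, mul_resolvent_zero hP, one_mul,
      add_zero, ← tsum_mul_left, ← tsum_mul_left, add_sub_assoc, add_eq_left, sub_eq_zero]
    refine tsum_congr fun s => ?_
    rw [← mul_assoc, ← mul_assoc, mul_resolvent_succ hP, add_assoc, add_comm 1 s]

end Recurrence

/-! ### Estimates for products of consecutive terms -/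

section Products

/-- If `1 / (k - α)` has growth at most `D ρ ^ k`, then
`s! / ((k - α) (k + 1 - α) ⋯ (k + s - α))` is at most `D ρ ^ (k + s)`.  This quotient is the
`s`-th iterated difference of `1 / (k - α)`, so no loss occurs in the ultrametric inequality. -/
lemma norm_factorial_div_prod_le {K : Type*} [NontriviallyNormedField K] [IsUltrametricDist K]
    {α : K} (hα : ∀ k : ℕ, (k : K) - α ≠ 0) {D ρ : ℝ}
    (h1 : 1 ≤ ρ) (h : ∀ k : ℕ, ‖((k : K) - α)⁻¹‖ ≤ D * ρ ^ k) (k s : ℕ) :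
    ‖(s ! : K) * (∏ r ∈ Finset.range (s + 1), (((k + r : ℕ) : K) - α))⁻¹‖ ≤ D * ρ ^ (k + s) := by
  have hD : 0 ≤ D := by simpa using (norm_nonneg _).trans (h 0)
  induction s generalizing k with
  | zero => simpa using h k
  | succ s ih =>
    have key : ((s + 1)! : K) * (∏ r ∈ Finset.range (s + 2), (((k + r : ℕ) : K) - α))⁻¹ =
        (s ! : K) * (∏ r ∈ Finset.range (s + 1), (((k + r : ℕ) : K) - α))⁻¹ -
        (s ! : K) * (∏ r ∈ Finset.range (s + 1), (((k + 1 + r : ℕ) : K) - α))⁻¹ := by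
      rw [Finset.prod_range_succ _ (s + 1), Finset.prod_range_succ' _ s,
        Finset.prod_range_succ (fun r => ((k + 1 + r : ℕ) : K) - α) s]
      have e : ∀ r, k + 1 + r = k + (r + 1) := fun r => by ring
      simp only [e]
      have hne : ∏ r ∈ Finset.range s, (((k + (r + 1) : ℕ) : K) - α) ≠ 0 :=
        Finset.prod_ne_zero_iff.2 fun r _ => hα _
      have h2 := hα (k + 0)
      have h3 := hα (k + (s + 1))
      rw [Nat.factorial_succ]
      field_simp
      push_cast
      ring
    rw [key]
    rw [sub_eq_add_neg]
    refine (IsUltrametricDist.norm_add_le_max _ _).trans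
      (max_le ((ih k).trans ?_) ((norm_neg _).trans_le ?_))
    · gcongr
      exact Nat.le_succ s
    · rw [← add_assoc, add_right_comm]
      exact ih (k + 1)

variable {p : ℕ} [Fact p.Prime]

/-- The growth condition supplied by the convergence of `∑ t ^ k / (α - k)` for `|t| < 1`. -/
lemma exists_norm_inv_sub_le {α : ℤ_[p]} (hint : ∀ z : ℤ, α ≠ z) (hliou : ¬ IsPadicLiouville p α)
    {ρ : ℝ} (hρ : 1 < ρ) :
    ∃ D : ℝ, 0 < D ∧ ∀ k : ℕ, ‖((k : ℚ_[p]) - α)⁻¹‖ ≤ D * ρ ^ k := by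
  have h0 : 0 < ρ := by linarith
  have hrad := not_lt.1 (not_or.1 hliou).1
  obtain ⟨r, hr⟩ : ∃ r : NNReal, (r : ℝ) = ρ⁻¹ := ⟨⟨ρ⁻¹, by positivity⟩, rfl⟩
  have hlt : (r : ENNReal) < 1 := by
    rw [ENNReal.coe_lt_one_iff, ← NNReal.coe_lt_coe, hr]
    exact inv_lt_one_of_one_lt₀ hρ
  obtain ⟨C, hC, h⟩ :=
    FormalMultilinearSeries.norm_mul_pow_le_of_lt_radius _ (hlt.trans_le hrad)
  refine ⟨C, hC, fun k => ?_⟩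
  have hk := h k
  have hne : ¬ (k : ℤ_[p]) = α := fun e => hint k (by rw [← e, Int.cast_natCast])
  rw [FormalMultilinearSeries.ofScalars_norm, if_neg hne, one_div, hr, inv_pow,
    mul_inv_le_iff₀ (by positivity)] at hk
  rwa [norm_inv, norm_sub_rev, ← norm_inv]

lemma norm_prod_sub_le_norm_factorial (β : ℤ_[p]) (k s : ℕ) :
    ‖∏ r ∈ Finset.range s, (((k + r : ℕ) : ℤ_[p]) - β)‖ ≤ ‖(s ! : ℤ_[p])‖ := by
  have e : ∏ r ∈ Finset.range s, (((k + r : ℕ) : ℤ_[p]) - β) =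
      (ascPochhammer ℤ_[p] s).eval (k - β) := by
    induction s with
    | zero => simp
    | succ s ih =>
      rw [Finset.prod_range_succ, ih, ascPochhammer_succ_eval]
      push_cast
      ring
  rw [e]
  exact PadicInt.norm_ascPochhammer_le s _

variable {K : Type*} [NontriviallyNormedField K] [NormedAlgebra ℚ_[p] K]

lemma norm_natCast_padic (n : ℕ) : ‖(n : K)‖ = ‖(n : ℚ_[p])‖ := by
  rw [← map_natCast (algebraMap ℚ_[p] K), norm_algebraMap']

/-- Legendre's formula for the `p`-adic valuation of `s!`. -/
lemma norm_factorial_pow (s : ℕ) :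
    ‖(s ! : K)‖ ^ (p - 1) = (p : ℝ)⁻¹ ^ (s - (p.digits s).sum) := by
  rw [norm_natCast_padic (p := p), Padic.norm_eq_zpow_neg_valuation
    (Nat.cast_ne_zero.2 (Nat.factorial_ne_zero s)), Padic.valuation_natCast, zpow_neg,
    zpow_natCast, ← inv_pow, ← pow_mul, mul_comm, sub_one_mul_padicValNat_factorial]

variable {π : K}

lemma pow_le_norm_factorial (hπ : ‖π‖ ^ (p - 1) = (p : ℝ)⁻¹) (s : ℕ) :
    ‖π‖ ^ s ≤ ‖(s ! : K)‖ := by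
  have hp := (Fact.out : p.Prime).one_lt
  have hp' : (1 : ℝ) < p := by exact_mod_cast hp
  rw [← pow_le_pow_iff_left₀ (by positivity) (by positivity) (Nat.sub_ne_zero_of_lt hp),
    norm_factorial_pow, pow_right_comm, hπ]
  exact pow_le_pow_of_le_one (by positivity) (inv_le_one_of_one_le₀ hp'.le) (Nat.sub_le _ _)

lemma norm_factorial_le (hπ : ‖π‖ ^ (p - 1) = (p : ℝ)⁻¹) (s : ℕ) :
    ‖(s ! : K)‖ ≤ p * (s + 1) * ‖π‖ ^ s := by
  have hp := (Fact.out : p.Prime).one_lt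
  have hp' : (1 : ℝ) < p := by exact_mod_cast hp
  -- After raising to the power `p - 1` the bound says that the sum of the `p`-adic digits of `s` is
  -- at most `p - 1` times their number.
  rw [← pow_le_pow_iff_left₀ (by positivity) (by positivity) (Nat.sub_ne_zero_of_lt hp),
    norm_factorial_pow, mul_pow, pow_right_comm, hπ]
  have hS : (p.digits s).sum ≤ s := Nat.digit_sum_le p s
  have hlen : (p.digits s).sum ≤ (p.digits s).length * (p - 1) := by
    refine List.sum_le_card_nsmul _ _ fun d hd => ?_
    have := Nat.digits_lt_base hp hd
    omega
  have hpow : p ^ (p.digits s).length ≤ p * (s + 1) := by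
    rcases eq_or_ne s 0 with rfl | hs
    · simpa using hp.le
    · exact (Nat.base_pow_length_digits_le p s hp hs).trans (by gcongr; exact Nat.le_succ s)
  have hmain : (p : ℝ) ^ (p.digits s).sum ≤ (p * (s + 1)) ^ (p - 1) := by
    calc (p : ℝ) ^ (p.digits s).sum ≤ (p : ℝ) ^ ((p.digits s).length * (p - 1)) :=
          pow_le_pow_right₀ hp'.le hlen
      _ = ((p : ℝ) ^ (p.digits s).length) ^ (p - 1) := pow_mul _ _ _
      _ ≤ _ := by gcongr; exact_mod_cast hpow
  calc (p : ℝ)⁻¹ ^ (s - (p.digits s).sum)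
      = (p : ℝ) ^ (p.digits s).sum * (p : ℝ)⁻¹ ^ s := by
        rw [← pow_sub_mul_pow (p : ℝ)⁻¹ hS, mul_left_comm, ← mul_pow, mul_inv_cancel₀ (by positivity), one_pow, mul_one]
    _ ≤ _ := by gcongr

lemma isSubexponential_inv_prod [IsUltrametricDist K] (hπ : ‖π‖ ^ (p - 1) = (p : ℝ)⁻¹)
    {α : ℤ_[p]} (hint : ∀ z : ℤ, α ≠ z) (hliou : ¬ IsPadicLiouville p α) :
    IsSubexponential fun k s => ‖π‖ ^ s *
      ‖(∏ r ∈ Finset.range (s + 1), (((k + r : ℕ) : K) - algebraMap ℚ_[p] K α))⁻¹‖ := by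
  intro ρ hρ
  obtain ⟨D, hD, h⟩ := exists_norm_inv_sub_le hint hliou hρ
  have e : ∀ k : ℕ, (k : K) - algebraMap ℚ_[p] K α = algebraMap ℚ_[p] K (k - α) := fun k => by
    rw [map_sub, map_natCast]
  refine ⟨D, hD, fun k s => ?_⟩
  refine le_trans ?_ (norm_factorial_div_prod_le (α := algebraMap ℚ_[p] K α) ?_ hρ.le ?_ k s)
  · rw [norm_mul]
    exact mul_le_mul_of_nonneg_right (pow_le_norm_factorial hπ s) (norm_nonneg _)
  · intro k
    rw [e, map_ne_zero, sub_ne_zero]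
    intro h
    exact hint k (by rw [Int.cast_natCast]; exact Subtype.ext (by simpa using h.symm))
  · intro k
    rw [e, ← map_inv₀, norm_algebraMap']
    exact h k

lemma isSubexponential_prod (hπ : ‖π‖ ^ (p - 1) = (p : ℝ)⁻¹) (β : ℤ_[p]) :
    IsSubexponential fun k s => (‖π‖ ^ s)⁻¹ *
      ‖∏ r ∈ Finset.range s, (((k + r : ℕ) : K) - algebraMap ℚ_[p] K β)‖ := by
  have hp := (Fact.out : p.Prime)
  have hπ0 : 0 < ‖π‖ := by
    refine (norm_nonneg π).lt_of_ne fun h => ?_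
    rw [← h, zero_pow (Nat.sub_ne_zero_of_lt hp.one_lt)] at hπ
    exact inv_ne_zero (Nat.cast_ne_zero.2 hp.ne_zero) hπ.symm
  intro ρ hρ
  obtain ⟨D, hD, h⟩ := isSubexponential_linear (a := p) (by exact_mod_cast hp.pos) ρ hρ
  refine ⟨D, hD, fun k s => le_trans ?_ (h k s)⟩
  rw [inv_mul_le_iff₀ (by positivity), mul_comm]
  refine le_trans ?_ (norm_factorial_le hπ s)
  have e : ∏ r ∈ Finset.range s, (((k + r : ℕ) : K) - algebraMap ℚ_[p] K β) =
      algebraMap ℚ_[p] K ((∏ r ∈ Finset.range s, (((k + r : ℕ) : ℤ_[p]) - β) : ℤ_[p]) : ℚ_[p]) := by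
    refine Eq.symm ((map_prod ((algebraMap ℚ_[p] K).comp PadicInt.Coe.ringHom) _ _).trans
      (Finset.prod_congr rfl fun r _ => ?_))
    rw [map_sub, map_natCast]
    rfl
  rw [e, norm_algebraMap', norm_natCast_padic (p := p)]
  exact (norm_prod_sub_le_norm_factorial β k s).trans_eq (by rw [PadicInt.norm_def]; rfl)

end Products

/-! ### The absolute value of `π` -/

section ResidueField

variable {p : ℕ} [Fact p.Prime] (K : Type*) [NontriviallyNormedField K] [IsUltrametricDist K]
  [NormedAlgebra ℚ_[p] K]

lemma charP_residueField [IsDiscreteValuationRing (valRing K)] :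
    CharP (IsLocalRing.ResidueField (valRing K)) p := by
  rw [CharP.charP_iff_prime_eq_zero Fact.out, ← map_natCast (IsLocalRing.residue (valRing K)),
    IsLocalRing.residue_eq_zero_iff, IsLocalRing.mem_maximalIdeal, mem_nonunits_iff]
  intro hu
  obtain ⟨y, hy⟩ := hu.exists_right_inv
  have h1 : (p : K) * (y : K) = 1 := by simpa using congrArg Subtype.val hy
  have h2 := congrArg norm h1
  rw [norm_mul, norm_one, norm_natCast_padic (p := p)] at h2
  have h3 := (mem_valRing K _).1 y.2
  have h4 := Padic.norm_p_lt_one (p := p)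
  have : ‖(p : ℚ_[p])‖ * ‖(y : K)‖ ≤ ‖(p : ℚ_[p])‖ := mul_le_of_le_one_right (norm_nonneg _) h3
  linarith

/-- The exponent `(q - 1) / (p - 1)` is exact, since `q` is a power of `p`. -/
lemma norm_pow_eq_inv_prime [IsDiscreteValuationRing (valRing K)]
    [Finite (IsLocalRing.ResidueField (valRing K))] {q : ℕ}
    (hq : Nat.card (IsLocalRing.ResidueField (valRing K)) = q) {π : K}
    (hπ : π ^ (q - 1) + (-(p : K)) ^ ((q - 1) / (p - 1)) = 0) :
    ‖π‖ ^ (p - 1) = (p : ℝ)⁻¹ := by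
  have hp := (Fact.out : p.Prime)
  have := charP_residueField (p := p) K
  have := Fintype.ofFinite (IsLocalRing.ResidueField (valRing K))
  obtain ⟨f, -, hf⟩ := FiniteField.card (IsLocalRing.ResidueField (valRing K)) p
  rw [← Nat.card_eq_fintype_card, hq] at hf
  obtain ⟨t, ht⟩ : p - 1 ∣ q - 1 := by
    rw [hf]
    simpa using Nat.sub_dvd_pow_sub_pow p 1 f
  have hp1 : 0 < p - 1 := Nat.sub_pos_of_lt hp.one_lt
  have ht0 : t ≠ 0 := by
    rintro rfl
    have : 1 < q := hf ▸ Nat.one_lt_pow f.ne_zero hp.one_lt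
    omega
  rw [ht, Nat.mul_div_cancel_left _ hp1, add_eq_zero_iff_eq_neg] at hπ
  have h := congrArg norm hπ
  rw [norm_neg, norm_pow, norm_pow, norm_neg, norm_natCast_padic (p := p), Padic.norm_p,
    pow_mul] at h
  exact (pow_left_inj₀ (by positivity) (by positivity) ht0).1 h

end ResidueField

/-! ### Right multiplication by the hypergeometric operator modulo `A₁(K)†` -/

section Inclusion

variable {K : Type*} [NontriviallyNormedField K] [IsUltrametricDist K] [CompleteSpace K]

/-- The image of the hypergeometric operator of `A₁(K)†` in the algebra of operators. -/
lemma coe_incl_hypOp (p : ℕ) (π : K) {m n : ℕ} (α : Fin m → K) (β : Fin n → K) :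
    ((incl K (hypOp (A1.x K) (A1.d K) p π α β) : B1 K) : OpAlg K) =
      hypOp (monoOp K 1 0) (monoOp K 0 1) p π α β :=
  map_hypOp (A1 K).val (A1.x K) (A1.d K) p π α β

lemma incl_hypOp (p : ℕ) (π : K) {m n : ℕ} (α : Fin m → K) (β : Fin n → K) :
    incl K (hypOp (A1.x K) (A1.d K) p π α β) = hypOp (B1.x K) (B1.d K) p π α β :=
  map_hypOp (Subalgebra.inclusion (A1_le_B1 K)) (A1.x K) (A1.d K) p π α β

lemma mem_range_incl (b : B1 K) : b ∈ (incl K).range ↔ (b : OpAlg K) ∈ A1 K :=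
  ⟨fun ⟨a, ha⟩ => ha ▸ a.2, fun h => ⟨⟨b, h⟩, rfl⟩⟩

lemma isUnit_B1_x : IsUnit (B1.x K) := by
  have hy : monoOp K (-1) 0 ∈ B1 K := ⟨singleCoeff (-1) 0 1, isOverconvergentB_singleCoeff _ _ _, by
    simpa only [one_smul] using hasSum_singleCoeff K (-1) 0 1⟩
  refine ⟨⟨B1.x K, ⟨_, hy⟩, Subtype.ext ?_, Subtype.ext ?_⟩, rfl⟩
  · change monoOp K 1 0 * monoOp K (-1) 0 = 1
    simp [monoOp_mul, monoOp_zero_zero]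
  · change monoOp K (-1) 0 * monoOp K 1 0 = 1
    simp [monoOp_mul, monoOp_zero_zero]

end Inclusion

section RightMultiplication

variable {p : ℕ} [Fact p.Prime] {K : Type*} [NontriviallyNormedField K] [IsUltrametricDist K]
  [NormedAlgebra ℚ_[p] K] {π : K}

/-- The factors `|π| ^ s` attached to the linear factors of `P` and `Q` cancel the factorials in
the two products, because `|c| = |π| ^ (m - n)`. -/
lemma isSubexponential_resolvent (hπ : ‖π‖ ^ (p - 1) = (p : ℝ)⁻¹) {m n : ℕ} {α : Fin m → ℤ_[p]}
    (β : Fin n → ℤ_[p]) (hint : ∀ (i : Fin m) (z : ℤ), α i ≠ (z : ℤ_[p]))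
    (hliou : ∀ i : Fin m, ¬ IsPadicLiouville p (α i)) :
    IsSubexponential fun k s => ‖resolvent (fun k => ∏ i, ((k : K) - toField p K α i))
      (fun k => (-1) ^ (m + n * p) * π ^ ((m : ℤ) - n) * ∏ j, ((k : K) - toField p K β j)) k s‖ := by
  have hp := (Fact.out : p.Prime)
  have hπ0 : π ≠ 0 := by
    rintro rfl
    rw [norm_zero, zero_pow (Nat.sub_ne_zero_of_lt hp.one_lt)] at hπ
    exact inv_ne_zero (Nat.cast_ne_zero.2 hp.ne_zero) hπ.symm
  have h := (IsSubexponential.prod Finset.univ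
      (fun i => isSubexponential_inv_prod hπ (hint i) (hliou i))
      (fun _ _ _ => by positivity)).mul
    (IsSubexponential.prod Finset.univ (fun j => isSubexponential_prod hπ (β j))
      (fun _ _ _ => by positivity))
    (fun _ _ => Finset.prod_nonneg fun _ _ => by positivity)
  convert h using 3 with k s
  rw [resolvent, Finset.prod_mul_distrib, Finset.prod_const, Finset.card_range,
    Finset.prod_comm (s := Finset.range s), Finset.prod_comm (s := Finset.range (s + 1)),
    Finset.prod_mul_distrib, Finset.prod_mul_distrib, Finset.prod_const, Finset.prod_const,
    Finset.card_univ, Finset.card_univ, Fintype.card_fin, Fintype.card_fin, norm_mul, norm_mul,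
    norm_pow, norm_mul, norm_pow, norm_neg, norm_one, one_pow, one_mul, norm_zpow,
    zpow_sub₀ (norm_ne_zero_iff.2 hπ0), zpow_natCast, zpow_natCast, norm_inv, norm_prod, norm_prod]
  simp only [norm_inv, Finset.prod_inv_distrib]
  have := norm_ne_zero_iff.2 hπ0
  simp only [toField]
  rw [div_pow, inv_pow, ← pow_mul, ← pow_mul, ← pow_mul, ← pow_mul, mul_comm m s, mul_comm n s]
  ring

variable [CompleteSpace K]

/-- The natural map `A₁(K)† / A₁(K)† Hyp → B₁(K)† / B₁(K)† Hyp` is bijective. -/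
lemma cyclicMap_hypOp_bijective (hπ : ‖π‖ ^ (p - 1) = (p : ℝ)⁻¹) {m n : ℕ}
    {α : Fin m → ℤ_[p]} (β : Fin n → ℤ_[p])
    (hint : ∀ (i : Fin m) (z : ℤ), α i ≠ (z : ℤ_[p]))
    (hliou : ∀ i : Fin m, ¬ IsPadicLiouville p (α i)) :
    Function.Bijective (cyclicMap (incl K)
      (hypOp (A1.x K) (A1.d K) p π (toField p K α) (toField p K β))) := by
  have hfactor : ∀ (i : Fin m) (k : ℕ),
      (k : K) - toField p K α i = algebraMap ℚ_[p] K ((k : ℤ_[p]) - α i : ℤ_[p]) := by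
    intro i k
    simp [toField]
  have hP : ∀ k : ℕ, ∏ i, ((k : K) - toField p K α i) ≠ 0 := by
    refine fun k => Finset.prod_ne_zero_iff.2 fun i _ => ?_
    rw [hfactor, map_ne_zero, ne_eq, PadicInt.coe_eq_zero, sub_eq_zero]
    exact fun h => hint i k (by rw [Int.cast_natCast, h])
  have hP1 : ∀ k : ℕ, ‖∏ i, ((k : K) - toField p K α i)‖ ≤ 1 := by
    intro k
    rw [norm_prod]
    refine Finset.prod_le_one (fun _ _ => norm_nonneg _) fun i _ => ?_
    rw [hfactor, norm_algebraMap']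
    exact PadicInt.norm_le_one _
  have hw := isSubexponential_resolvent hπ β hint hliou
  have hinj : Function.Injective (incl K) := Subalgebra.inclusion_injective (A1_le_B1 K)
  refine cyclicMap_bijective (incl K) hinj _ ?_ ?_
  · intro b hb
    rw [mem_range_incl, mem_A1_iff_principalPart_eq_zero (SetLike.coe_mem _)] at hb
    rw [mem_range_incl, mem_A1_iff_principalPart_eq_zero b.2]
    intro l k
    obtain ⟨C, hC, η, h0, h1, h⟩ := exists_norm_principalPart_le b.2
    refine eq_zero_of_recurrence (f := principalPart (b : OpAlg K) l) (C := C) (η := η)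
      hP hP1 hw h0 h1 (fun k => (h l k).trans ?_) (fun k => ?_) k
    · exact mul_le_mul_of_nonneg_left
        (pow_le_pow_of_le_one h0.le h1.le (Nat.le_add_left k l)) hC.le
    · rw [← principalPart_mul_hypOp, ← coe_incl_hypOp]
      exact hb l k
  · intro b
    obtain ⟨C, hC, η, h0, h1, h⟩ := exists_norm_principalPart_le b.2
    obtain ⟨f, ⟨C', hC', η', h0', h1', hf⟩, hrec⟩ := exists_recurrence hP hw hC h0 h1 h
    obtain ⟨T, hT, hTf⟩ := exists_principalPart_eq hC' h0' h1' hf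
    refine ⟨⟨T, hT⟩, ?_⟩
    rw [mem_range_incl, mem_A1_iff_principalPart_eq_zero (SetLike.coe_mem _)]
    intro l k
    rw [Subalgebra.coe_sub, Subalgebra.coe_mul, coe_incl_hypOp, principalPart_sub,
      principalPart_mul_hypOp, hTf, hTf, hrec, sub_self]

end RightMultiplication

end ArithD

end

theorem lemma2p3 (p : ℕ) [Fact p.Prime]
    (K : Type*) [NontriviallyNormedField K] [IsUltrametricDist K] [CompleteSpace K]
    [NormedAlgebra ℚ_[p] K] [IsDiscreteValuationRing (ArithD.valRing K)]
    [Finite (IsLocalRing.ResidueField (ArithD.valRing K))]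
    (q : ℕ) (hq : Nat.card (IsLocalRing.ResidueField (ArithD.valRing K)) = q) (π : K)
    (hπ : π ^ (q - 1) + (-(p : K)) ^ ((q - 1) / (p - 1)) = 0)
    {m n : ℕ} (α : Fin m → ℤ_[p]) (β : Fin n → ℤ_[p])
    (hint : ∀ (i : Fin m) (z : ℤ), α i ≠ (z : ℤ_[p]))
    (hliou : ∀ i : Fin m, ¬ ArithD.IsPadicLiouville p (α i)) :
    Function.Bijective
      (fun v : ArithD.HypModA K p π (ArithD.toField p K α) (ArithD.toField p K β) => ArithD.A1.x K • v) ∧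
    Nonempty
      (ArithD.JPullback K (ArithD.HypModA K p π (ArithD.toField p K α) (ArithD.toField p K β)) ≃ₗ[ArithD.B1 K]
        ArithD.HypModB K p π (ArithD.toField p K α) (ArithD.toField p K β)) ∧
    Function.Bijective (ArithD.jUnit K (ArithD.HypModA K p π (ArithD.toField p K α) (ArithD.toField p K β))) := by
  have hunit : Function.Bijective (ArithD.jUnit K
      (ArithD.HypModA K p π (ArithD.toField p K α) (ArithD.toField p K β))) := by
    refine ((ArithD.extendCyclicEquiv (ArithD.incl K) _).bijective.of_comp_iff' _).1 ?_
    have h := ArithD.cyclicMap_hypOp_bijective (ArithD.norm_pow_eq_inv_prime K hq hπ) β hint hliou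
    rwa [← funext (ArithD.extendCyclicEquiv_extendUnit (ArithD.incl K) _)] at h
  refine ⟨(hunit.of_comp_iff' _).1 ?_, ⟨?_⟩, hunit⟩
  · -- On `j^* M` the coordinate `x` is invertible, and `M → j_+ j^* M` commutes with `x`.
    obtain ⟨u, hu⟩ := ArithD.isUnit_B1_x (K := K)
    have h := (MulAction.bijective u (β := ArithD.JPullback K
      (ArithD.HypModA K p π (ArithD.toField p K α) (ArithD.toField p K β)))).comp hunit
    refine (congrArg Function.Bijective (funext fun v => ?_)).mpr h
    refine (map_smul (ArithD.jUnit K _) (ArithD.A1.x K) v).trans ?_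
    exact congrArg (fun b : ArithD.B1 K =>
      b • (show ArithD.JPullback K _ from ArithD.jUnit K _ v)) hu.symm
  · change _ ≃ₗ[ArithD.B1 K] (ArithD.B1 K ⧸ Submodule.span (ArithD.B1 K)
      {ArithD.hypOp (ArithD.B1.x K) (ArithD.B1.d K) p π _ _})
    rw [← ArithD.incl_hypOp]
    exact ArithD.extendCyclicEquiv (ArithD.incl K) _
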